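/- Units are $c=G=\hbar=k_B=1$ and the signature is $(-,+,+,+)$. Let $(M,g)$ be a smooth four-dimensional spacetime with Levi-Civita connection $\nabla$, and let $T_{ab}$ be the stress-energy tensor, so that Einstein's equation $R_{ab}-\tfrac12 R\,g_{ab}=8\pi T_{ab}$ holds. Let $L\subset M$ be a light sheet starting at a spacelike 2-surface $B$. That is, $L$ is a smooth null hypersurface swept out by affinely parametrized null geodesics (the generators) with nowhere vanishing tangent field $k^a$, which start at $B$ at parameter value $\lambda=0$, run over $\lambda\ge 0$ and are orthogonal to $B$; the field $k^a$ is taken to be the restriction to $L$ of a smooth nowhere vanishing null vector field on an open neighbourhood $U$ of $L$; and the expansion $\theta=\nabla_a k^a$ is non-positive on $L$. The generators may end anywhere before a caustic, and their end points may or may not belong to $L$. Let $s^a$ be an entropy current, i.e. a $C^1$ vector field on $U$, and put $s=-k_a s^a$ and $s'=k^a\nabla_a s$. Suppose that the Strominger–Thompson conditions hold: (i) $s'\le 2\pi\,T_{ab}k^ak^b$ at every point of $L$; (ii) $s\le-\tfrac14\theta$ at every point of the initial surface $B$ (where $\lambda=0$). Then $s\le-\tfrac14\theta$ at every point of $L$.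 -/

import Mathlib

open scoped Manifold ContDiff Topology

noncomputable section

/-- The model space of a four-dimensional spacetime. -/
abbrev E4 : Type := EuclideanSpace ℝ (Fin 4)

/-- The model space of a two-dimensional surface. -/
abbrev E2 : Type := EuclideanSpace ℝ (Fin 2)

section Spacetime

variable {M : Type*} [TopologicalSpace M] [ChartedSpace E4 M] [IsManifold (𝓡 4) ∞ M]

variable (M) in
/-- A smooth Lorentzian metric of signature `(-,+,+,+)` on a four-manifold: a smooth field of
symmetric bilinear forms such that at every point there is a timelike vector on whose orthogonal
complement the form is positive definite. -/
structure LorentzMetric where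
  /-- The bilinear form on each tangent space. -/
  form : Π x : M, TangentSpace (𝓡 4) x →L[ℝ] TangentSpace (𝓡 4) x →L[ℝ] ℝ
  symm : ∀ (x : M) (u v : TangentSpace (𝓡 4) x), form x u v = form x v u
  lorentzian : ∀ x : M, ∃ t : TangentSpace (𝓡 4) x, form x t t < 0 ∧
    ∀ v : TangentSpace (𝓡 4) x, form x t v = 0 → v ≠ 0 → 0 < form x v v
  smooth : ContMDiff (𝓡 4) ((𝓡 4).prod 𝓘(ℝ, E4 →L[ℝ] E4 →L[ℝ] ℝ)) ∞
    (fun x ↦ Bundle.TotalSpace.mk' (E4 →L[ℝ] E4 →L[ℝ] ℝ)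
      (E := fun x : M ↦ TangentSpace (𝓡 4) x →L[ℝ] TangentSpace (𝓡 4) x →L[ℝ] ℝ) x (form x))

/-- The coordinate vector `∂ᵢ` at `x`, for the preferred chart at `x`. (In Mathlib the tangent
space at `x` is the model space, identified through that chart.) -/
def coordVec (x : M) (i : Fin 4) : TangentSpace (𝓡 4) x :=
  (EuclideanSpace.single i (1 : ℝ) : E4)

/-- The `i`-th component of a tangent vector at `x`, for the preferred chart at `x`. -/
def coordComp (x : M) (i : Fin 4) : TangentSpace (𝓡 4) x →L[ℝ] ℝ :=
  (EuclideanSpace.proj i : E4 →L[ℝ] ℝ)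

/-- The coordinate vector field `y ↦ ∂ᵢ|_y` of the preferred chart at `x` (meaningful for `y` in
the domain of that chart). -/
def coordField (x : M) (i : Fin 4) : Π y : M, TangentSpace (𝓡 4) y :=
  FiberBundle.extend E4 (coordVec x i)

namespace LorentzMetric

variable (g : LorentzMetric M)

/-- The metric components `g_ij` at the point `x`, in the preferred chart at `x`. -/
def gram (x : M) : Matrix (Fin 4) (Fin 4) ℝ :=
  Matrix.of fun i j ↦ g.form x (coordVec x i) (coordVec x j)

/-- The partial derivative `∂ₗ g_ij` at the point `x`, in the preferred chart at `x`. -/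
def dGram (x : M) (l i j : Fin 4) : ℝ :=
  mvfderiv (𝓡 4) (fun y ↦ g.form y (coordField x i y) (coordField x j y)) x (coordVec x l)

/-- The Christoffel symbol `Γᵐᵢⱼ` at the point `x`, in the preferred chart at `x`:
`Γᵐᵢⱼ = ½ ∑ₗ gᵐˡ (∂ᵢ g_jl + ∂ⱼ g_il - ∂ₗ g_ij)`. -/
def christoffel (x : M) (m i j : Fin 4) : ℝ :=
  (1 / 2) * ∑ l, (g.gram x)⁻¹ m l * (g.dGram x i j l + g.dGram x j i l - g.dGram x l i j)

/-- The bilinear map `(w, v) ↦ ∑ Γᵐᵢⱼ vⁱ wʲ ∂ₘ` at `x`. -/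
def christoffelForm (x : M) :
    TangentSpace (𝓡 4) x →L[ℝ] TangentSpace (𝓡 4) x →L[ℝ] TangentSpace (𝓡 4) x :=
  ∑ m, ∑ i, ∑ j, (coordComp x j).smulRight
    ((coordComp x i).smulRight (g.christoffel x m i j • coordVec x m))

end LorentzMetric

/-- The components of a vector field `Y` at a point `y`, in the preferred chart at `x`. -/
def chartRep (x : M) (Y : Π y : M, TangentSpace (𝓡 4) y) (y : M) : E4 :=
  (trivializationAt E4 (TangentSpace (𝓡 4) : M → Type) x ⟨y, Y y⟩).2

/-- The linear map `v ↦ (vⁱ ∂ᵢ Yᵐ) ∂ₘ` at `x`, in the preferred chart at `x`. -/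
def chartDeriv (Y : Π y : M, TangentSpace (𝓡 4) y) (x : M) :
    TangentSpace (𝓡 4) x →L[ℝ] TangentSpace (𝓡 4) x :=
  mvfderiv (𝓡 4) (chartRep x Y) x

theorem chartRep_self (x : M) (Y : Π y : M, TangentSpace (𝓡 4) y) : chartRep x Y x = Y x := by
  have h := TangentBundle.continuousLinearMapAt_trivializationAt_eq_core (I := 𝓡 4)
    (mem_chart_source E4 x)
  have hx : x ∈ (trivializationAt E4 (TangentSpace (𝓡 4) : M → Type) x).baseSet :=
    FiberBundle.mem_baseSet_trivializationAt' x
  have h2 : chartRep x Y x =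
      (trivializationAt E4 (TangentSpace (𝓡 4) : M → Type) x).continuousLinearMapAt ℝ x (Y x) := by
    rw [Bundle.Trivialization.continuousLinearMapAt_apply, Bundle.Trivialization.linearMapAt_apply,
      if_pos hx]
    rfl
  rw [h2, h]
  exact (tangentBundleCore (𝓡 4) M).coordChange_self _ _ (mem_chart_source E4 x) _

theorem mdifferentiableAt_chartRep {x : M} {Y : Π y : M, TangentSpace (𝓡 4) y}
    (hY : MDifferentiableAt (𝓡 4) ((𝓡 4).prod 𝓘(ℝ, E4))
      (fun y ↦ (⟨y, Y y⟩ : TangentBundle (𝓡 4) M)) x) :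
    MDifferentiableAt (𝓡 4) 𝓘(ℝ, E4) (chartRep x Y) x :=
  (mdifferentiableAt_section _ Y).1 hY

theorem eventually_mem_baseSet (x : M) :
    ∀ᶠ y in 𝓝 x, y ∈ (trivializationAt E4 (TangentSpace (𝓡 4) : M → Type) x).baseSet :=
  (trivializationAt E4 (TangentSpace (𝓡 4) : M → Type) x).open_baseSet.mem_nhds
    (FiberBundle.mem_baseSet_trivializationAt' x)

theorem chartDeriv_congr {x : M} {Y : Π y : M, TangentSpace (𝓡 4) y} {F : M → E4}
    (h : chartRep x Y =ᶠ[𝓝 x] F) :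
    chartDeriv Y x = (mvfderiv (𝓡 4) F x : TangentSpace (𝓡 4) x →L[ℝ] E4) := by
  ext v
  have h1 : mfderiv (𝓡 4) 𝓘(ℝ, E4) (chartRep x Y) x = mfderiv (𝓡 4) 𝓘(ℝ, E4) F x :=
    h.mfderiv_eq
  exact congrArg (fun L : TangentSpace (𝓡 4) x →L[ℝ] E4 ↦ L v) h1

/-- The Levi-Civita connection: `(∇_v Y)ᵐ = vⁱ ∂ᵢ Yᵐ + Γᵐᵢⱼ vⁱ Yʲ` at the point `x`, in the
preferred chart at `x`. -/
def LorentzMetric.leviCivita (g : LorentzMetric M) :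
    CovariantDerivative (𝓡 4) E4 (TangentSpace (𝓡 4) : M → Type) where
  toFun Y x := chartDeriv Y x + g.christoffelForm x (Y x)
  isCovariantDerivativeOnUniv :=
    { add := by
        intro Y Z x hY hZ _
        have h : chartRep x (Y + Z) =ᶠ[𝓝 x] chartRep x Y + chartRep x Z := by
          filter_upwards [eventually_mem_baseSet x] with y hy
          exact ((trivializationAt E4 (TangentSpace (𝓡 4) : M → Type) x).linear ℝ hy).map_add _ _
        have : chartDeriv (Y + Z) x = chartDeriv Y x + chartDeriv Z x :=
          (chartDeriv_congr h).trans
            (mvfderiv_add (mdifferentiableAt_chartRep hY) (mdifferentiableAt_chartRep hZ))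
        rw [this, Pi.add_apply, map_add]
        abel
      leibniz := by
        intro Y f x hY hf _
        have : chartDeriv (f • Y) x = f x • chartDeriv Y x
            + (mvfderiv (𝓡 4) f x).smulRight (Y x) := by
          have h : chartRep x (f • Y) =ᶠ[𝓝 x] f • chartRep x Y := by
            filter_upwards [eventually_mem_baseSet x] with y hy
            exact ((trivializationAt E4 (TangentSpace (𝓡 4) : M → Type) x).linear ℝ hy).map_smul _ _
          refine (chartDeriv_congr h).trans
            ((mvfderiv_smul hf (mdifferentiableAt_chartRep hY)).trans ?_)
          rw [chartRep_self]
          rfl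
        rw [this, Pi.smul_apply', map_smul, smul_add]
        abel }

/-- The Riemann curvature `R(u,v)w = ∇_U ∇_V W - ∇_V ∇_U W - ∇_[U,V] W` at `x`, where `U`, `V`, `W`
are the vector fields near `x` that extend `u`, `v`, `w` with constant components in the preferred
chart at `x` (the value does not depend on the choice of smooth extensions). -/
def LorentzMetric.riemann (g : LorentzMetric M) (x : M) (u v w : TangentSpace (𝓡 4) x) :
    TangentSpace (𝓡 4) x :=
  let U : Π y : M, TangentSpace (𝓡 4) y := FiberBundle.extend E4 u
  let V : Π y : M, TangentSpace (𝓡 4) y := FiberBundle.extend E4 v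
  let W : Π y : M, TangentSpace (𝓡 4) y := FiberBundle.extend E4 w
  g.leviCivita (fun y ↦ g.leviCivita W y (V y)) x (U x)
    - g.leviCivita (fun y ↦ g.leviCivita W y (U y)) x (V x)
    - g.leviCivita W x (VectorField.mlieBracket (𝓡 4) U V x)

/-- The Ricci curvature `Ric(v,w)`, the trace of `u ↦ R(u,v)w`. -/
def LorentzMetric.ricci (g : LorentzMetric M) (x : M) (v w : TangentSpace (𝓡 4) x) : ℝ :=
  ∑ i, coordComp x i (g.riemann x (coordVec x i) v w)

/-- The scalar curvature `gⁱʲ R_ij`. -/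
def LorentzMetric.scalarCurvature (g : LorentzMetric M) (x : M) : ℝ :=
  ∑ i, ∑ j, (g.gram x)⁻¹ i j * g.ricci x (coordVec x i) (coordVec x j)

/-- Einstein's equation `R_ab - ½ R g_ab = 8π T_ab`, in units with `c = G = 1`. -/
def LorentzMetric.EinsteinEquation (g : LorentzMetric M)
    (T : Π x : M, TangentSpace (𝓡 4) x →L[ℝ] TangentSpace (𝓡 4) x →L[ℝ] ℝ) : Prop :=
  ∀ (x : M) (u v : TangentSpace (𝓡 4) x),
    g.ricci x u v - (1 / 2) * g.scalarCurvature x * g.form x u v = 8 * Real.pi * T x u v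

/-- The expansion `θ = ∇_a kᵃ`, the trace of `v ↦ ∇_v k`. -/
def LorentzMetric.expansion (g : LorentzMetric M) (k : Π x : M, TangentSpace (𝓡 4) x) (x : M) : ℝ :=
  LinearMap.trace ℝ (TangentSpace (𝓡 4) x) (g.leviCivita k x).toLinearMap

/-- The entropy flux `s = -k_a σᵃ` of an entropy current `σ`. -/
def LorentzMetric.entropyFlux (g : LorentzMetric M) (k σ : Π x : M, TangentSpace (𝓡 4) x)
    (x : M) : ℝ :=
  -g.form x (k x) (σ x)

/-- The rate of entropy flux `s' = kᵃ ∇_a s`. -/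
def LorentzMetric.entropyFluxRate (g : LorentzMetric M) (k σ : Π x : M, TangentSpace (𝓡 4) x)
    (x : M) : ℝ :=
  mvfderiv (𝓡 4) (g.entropyFlux k σ) x (k x)

variable {S : Type*} [TopologicalSpace S] [ChartedSpace E2 S] [IsManifold (𝓡 2) ∞ S]

/-- `IsLightSheet g U k D Φ`: the points `Φ x l` with `(x, l) ∈ D` form a light sheet with tangent
field `k`. Here `x` runs through the two-manifold `S` that parametrizes the initial surface
`B = {Φ x 0}`, and `l` is the affine parameter of the generator `Φ x`, which starts at `l = 0`. The
null vector field `k` is defined on an open neighbourhood `U` of the light sheet. -/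
structure IsLightSheet (g : LorentzMetric M) (U : Set M) (k : Π x : M, TangentSpace (𝓡 4) x)
    (D : Set (S × ℝ)) (Φ : S → ℝ → M) : Prop where
  -- the null vector field near the light sheet
  isOpen : IsOpen U
  smooth : ContMDiffOn (𝓡 4) ((𝓡 4).prod 𝓘(ℝ, E4)) ∞
    (fun y ↦ (⟨y, k y⟩ : TangentBundle (𝓡 4) M)) U
  ne_zero : ∀ y ∈ U, k y ≠ 0
  null : ∀ y ∈ U, g.form y (k y) (k y) = 0
  -- the initial surface: spacelike and orthogonal to `k`
  surface_smooth : ContMDiff (𝓡 2) (𝓡 4) ∞ (fun x ↦ Φ x 0)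
  surface_spacelike : ∀ (x : S) (v : TangentSpace (𝓡 2) x), v ≠ 0 →
    0 < g.form (Φ x 0) (mfderiv (𝓡 2) (𝓡 4) (fun x ↦ Φ x 0) x v)
      (mfderiv (𝓡 2) (𝓡 4) (fun x ↦ Φ x 0) x v)
  surface_orthogonal : ∀ (x : S) (v : TangentSpace (𝓡 2) x),
    g.form (Φ x 0) (k (Φ x 0)) (mfderiv (𝓡 2) (𝓡 4) (fun x ↦ Φ x 0) x v) = 0
  -- the parameter domain: every generator starts at `l = 0`, and the parameters strictly between
  -- the ends of the generators are interior
  zero_mem : ∀ x : S, (x, (0 : ℝ)) ∈ D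
  nonneg : ∀ p ∈ D, 0 ≤ p.2
  mem_interior : ∀ (x : S) (l m : ℝ), (x, l) ∈ D → 0 < m → m < l → (x, m) ∈ interior D
  mem_nhd : ∀ p ∈ D, Φ p.1 p.2 ∈ U
  -- the generators: integral curves of `k`, and affinely parametrized geodesics
  generator : ∀ x : S, IsMIntegralCurveOn (Φ x) k {l | (x, l) ∈ D}
  geodesic : ∀ p ∈ D, g.leviCivita k (Φ p.1 p.2) (k (Φ p.1 p.2)) = 0
  -- they sweep out a null hypersurface
  hypersurface_smooth : ContMDiffOn ((𝓡 2).prod 𝓘(ℝ, ℝ)) (𝓡 4) ∞ (fun p : S × ℝ ↦ Φ p.1 p.2)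
    (interior D)
  hypersurface_immersed : ∀ p ∈ interior D, Function.Injective
    (mfderiv ((𝓡 2).prod 𝓘(ℝ, ℝ)) (𝓡 4) (fun p : S × ℝ ↦ Φ p.1 p.2) p)
  hypersurface_null : ∀ p ∈ interior D, ∀ v : TangentSpace ((𝓡 2).prod 𝓘(ℝ, ℝ)) p,
    g.form (Φ p.1 p.2) (k (Φ p.1 p.2))
      (mfderiv ((𝓡 2).prod 𝓘(ℝ, ℝ)) (𝓡 4) (fun p : S × ℝ ↦ Φ p.1 p.2) p v) = 0
  -- non-positive expansion
  expansion_nonpos : ∀ p ∈ D, g.expansion k (Φ p.1 p.2) ≤ 0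

end Spacetime

end

/-! Along a generator the quantity `s + θ/4` does not increase, and it is non-positive at `λ = 0`.
Its derivative is `s' + θ'/4`. Raychaudhuri's inequality gives `θ' ≤ -R_ab kᵃ kᵇ`, and Einstein's
equation contracted with the null vector `k` gives `R_ab kᵃ kᵇ = 8π T_ab kᵃ kᵇ`, so condition (i)
bounds the derivative by `2π T_ab kᵃ kᵇ - 2π T_ab kᵃ kᵇ = 0`.

Raychaudhuri's inequality (`fderiv_trace_covDeriv_le`) is proved without splitting into expansion
and shear. Write `B = ∇k` and `a = ∇_k k`. Where `a = 0`, the contracted Ricci identity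
(`trace_fderiv_acceleration`) reads `div a = k(θ) + Ric(k,k) + tr B²`. The term `tr B²` is
non-negative (`trace_comp_self_nonneg`): `B` kills `k`, takes values in `k^⊥` because `k` is null
nearby, and is symmetric on `k^⊥` because `k` is normal to a hypersurface (`apply_covDeriv_symm`);
the metric is positive semidefinite on `k^⊥`. The term `div a` is zero although `a` is known to
vanish only on the light sheet: the derivative of `a` kills the tangent space `k^⊥` of the sheet and
takes values in `k^⊥`, so its square is zero.

These computations are done for fields on a vector space. The connection of the statement is defined
at each point through the preferred chart at that point, so differentiating `θ` requires one fixed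
chart near the point. The passage rests on the transformation law `covDeriv_pullback`, from which
`leviCivita_fromChart`, `expansion_eq` and `ricci_eq` follow. -/

noncomputable section

set_option maxSynthPendingDepth 3

/-! ### Linear algebra of Lorentzian forms and null vectors -/

section LorentzianForm

variable {V : Type*} [NormedAddCommGroup V] [NormedSpace ℝ V]

/-- A symmetric bilinear form of signature `(-,+,…,+)`. -/
structure IsLorentzianForm (g : V →L[ℝ] V →L[ℝ] ℝ) : Prop where
  symm : ∀ u v, g u v = g v u
  exists_timelike : ∃ t, g t t < 0 ∧ ∀ v, g t v = 0 → v ≠ 0 → 0 < g v v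

namespace IsLorentzianForm

variable {g : V →L[ℝ] V →L[ℝ] ℝ} (hg : IsLorentzianForm g)
include hg

theorem eq_zero_of_forall {v : V} (h : ∀ w, g v w = 0) : v = 0 := by
  obtain ⟨t, -, ht⟩ := hg.exists_timelike
  by_contra hv
  exact (ht v (by rw [hg.symm, h]) hv).ne' (h v)

theorem ext {u v : V} (h : ∀ w, g u w = g v w) : u = v :=
  sub_eq_zero.1 (hg.eq_zero_of_forall fun w ↦ by simp [h])

theorem isInvertible [FiniteDimensional ℝ V] : g.IsInvertible := by
  have hinj : Function.Injective g.toLinearMap := by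
    intro u v h
    exact hg.ext fun w ↦ congrArg (fun L : V →L[ℝ] ℝ ↦ L w) h
  have hdim : Module.finrank ℝ V = Module.finrank ℝ (V →L[ℝ] ℝ) := by
    rw [← Subspace.dual_finrank_eq (K := ℝ) (V := V)]
    exact (LinearMap.toContinuousLinearMap (𝕜 := ℝ) (E := V) (F' := ℝ)).finrank_eq
  refine ⟨(LinearEquiv.ofInjectiveOfFinrankEq g.toLinearMap hinj hdim).toContinuousLinearEquiv, ?_⟩
  ext; rfl

/-- A non-zero null vector cannot lie in the complement of a timelike vector, where the form is
positive definite. -/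
theorem exists_ne_zero {k : V} (hk : g k k = 0) (hk0 : k ≠ 0) :
    ∃ t, g k t ≠ 0 ∧ g t t < 0 ∧ ∀ v, g t v = 0 → v ≠ 0 → 0 < g v v := by
  obtain ⟨t, ht, htp⟩ := hg.exists_timelike
  refine ⟨t, fun h ↦ ?_, ht, htp⟩
  exact (htp k (by rw [hg.symm, h]) hk0).ne' hk

theorem nonneg_of_orthogonal_null {k v : V} (hk : g k k = 0) (hk0 : k ≠ 0) (hv : g k v = 0) :
    0 ≤ g v v ∧ (g v v = 0 → ∃ c : ℝ, v = c • k) := by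
  obtain ⟨t, hkt, -, htp⟩ := hg.exists_ne_zero hk hk0
  -- This `c` makes `v - c • k` orthogonal to the timelike `t`. Subtracting a multiple of `k` does
  -- not change `g v v`, since `k` is null and orthogonal to `v`.
  set c : ℝ := g t v / g k t
  have hvk : g v k = 0 := by rw [hg.symm, hv]
  have h1 : g t (v - c • k) = 0 := by
    simp only [map_sub, map_smul, smul_eq_mul, hg.symm t k, c]
    field_simp
    simp
  have h2 : g (v - c • k) (v - c • k) = g v v := by
    simp [hk, hv, hvk]
  by_cases h0 : v - c • k = 0
  · refine ⟨by rw [← h2, h0]; simp, fun _ ↦ ⟨c, sub_eq_zero.1 h0⟩⟩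
  · have := htp _ h1 h0
    rw [h2] at this
    exact ⟨this.le, fun h ↦ absurd h this.ne'⟩

variable [FiniteDimensional ℝ V]

/-- The range of `B` lies in `W = k^⊥`, so the trace may be taken on `W`. The form is degenerate
there but still has an orthogonal basis. A null basis vector is a multiple of `k` and is killed by
`B`; for any other `b`, symmetry of `B` gives the diagonal entry `g (B b) (B b) / g b b ≥ 0`. -/
theorem trace_comp_self_nonneg {k : V} (hk : g k k = 0) (hk0 : k ≠ 0) {B : V →ₗ[ℝ] V}
    (hBk : B k = 0) (hB : ∀ v, g (B v) k = 0)
    (hsymm : ∀ v w, g k v = 0 → g k w = 0 → g (B v) w = g (B w) v) :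
    0 ≤ LinearMap.trace ℝ V (B * B) := by
  let W : Submodule ℝ V := LinearMap.ker (g k).toLinearMap
  have memW : ∀ v, v ∈ W ↔ g k v = 0 := fun v ↦ by simp [W]
  have hBW : ∀ v, B v ∈ W := fun v ↦ by rw [memW, hg.symm, hB]
  rw [← LinearMap.trace_restrict_eq_of_forall_mem W (B * B) (fun v ↦ hBW (B v))]
  let q : LinearMap.BilinForm ℝ W :=
    LinearMap.mk₂ ℝ (fun u v : W ↦ g u v) (by simp) (by simp) (by simp) (by simp)
  have hq : ∀ u v : W, q u v = g u v := fun _ _ ↦ rfl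
  have : Invertible (2 : ℝ) := invertibleOfNonzero two_ne_zero
  obtain ⟨b, hb⟩ := LinearMap.BilinForm.exists_orthogonal_basis (B := q)
    ⟨fun u v ↦ by simpa [hq] using hg.symm u v⟩
  rw [LinearMap.trace_eq_matrix_trace ℝ b]
  refine Finset.sum_nonneg fun i _ ↦ ?_
  rw [Matrix.diag_apply, LinearMap.toMatrix_apply]
  have hbi : g k (b i) = 0 := (memW _).1 (b i).2
  obtain ⟨hnn, hz⟩ := hg.nonneg_of_orthogonal_null hk hk0 hbi
  set X : W →ₗ[ℝ] W := (B * B).restrict fun v _ ↦ hBW (B v)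
  rcases hnn.eq_or_lt with h0 | hpos
  · obtain ⟨c, hc⟩ := hz h0.symm
    have : X (b i) = 0 := by
      apply Subtype.ext
      simp [X, LinearMap.restrict_apply, hc, hBk]
    simp [this]
  · have h1 : q (X (b i)) (b i) = b.repr (X (b i)) i * q (b i) (b i) := by
      conv_lhs => rw [← b.sum_repr (X (b i))]
      rw [map_sum, LinearMap.sum_apply, Finset.sum_eq_single i]
      · simp
      · intro j _ hj
        have := hb hj
        simp only [Function.onFun] at this
        rw [map_smul, LinearMap.smul_apply, this, smul_zero]
      · simp
    have h2 : q (X (b i)) (b i) = g (B (b i)) (B (b i)) := by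
      rw [hq]
      simp only [X, LinearMap.restrict_apply, Module.End.mul_apply]
      exact hsymm _ _ ((memW _).1 (hBW _)) hbi
    have h3 := (hg.nonneg_of_orthogonal_null hk hk0 ((memW _).1 (hBW (b i)))).1
    rw [← h2, h1, hq] at h3
    exact nonneg_of_mul_nonneg_left h3 hpos

-- `C` maps everything into `k^⊥` and vanishes there, so `C² = 0`.
omit hg [FiniteDimensional ℝ V] in
theorem trace_eq_zero_of_isNilpotent {C : V →ₗ[ℝ] V} {k : V} (hC : ∀ v, g k v = 0 → C v = 0)
    (hCk : ∀ v, g k (C v) = 0) : LinearMap.trace ℝ V C = 0 := by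
  refine (LinearMap.isNilpotent_trace_of_isNilpotent ⟨2, ?_⟩).eq_zero
  ext v
  simpa [pow_two] using hC _ (hCk v)

end IsLorentzianForm

end LorentzianForm

/-! ### Christoffel symbols and covariant derivative in coordinates -/

section CoordinateGeometry

variable {V : Type*} [NormedAddCommGroup V] [NormedSpace ℝ V]

/-- The Christoffel symbols of a field `G` of bilinear forms on a vector space, as the bilinear map
`(v, u) ↦ ∑ Γᵐᵢⱼ uⁱ vʲ ∂ₘ`. -/
def christoffelMap (G : V → V →L[ℝ] V →L[ℝ] ℝ) (z : V) : V →L[ℝ] V →L[ℝ] V :=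
  (1 / 2 : ℝ) • (ContinuousLinearMap.compL ℝ V (V →L[ℝ] ℝ) V (G z).inverse).comp
    ((fderiv ℝ G z).flip + fderiv ℝ G z -
      ((ContinuousLinearMap.flipₗᵢ ℝ V V ℝ).toContinuousLinearEquiv :
        (V →L[ℝ] V →L[ℝ] ℝ) →L[ℝ] (V →L[ℝ] V →L[ℝ] ℝ)).comp (fderiv ℝ G z).flip)

/-- The covariant differential `v ↦ ∇_v K` of a vector field `K` on a vector space. -/
def covDeriv (G : V → V →L[ℝ] V →L[ℝ] ℝ) (K : V → V) (z : V) : V →L[ℝ] V :=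
  fderiv ℝ K z + christoffelMap G z (K z)

theorem covDeriv_apply (G : V → V →L[ℝ] V →L[ℝ] ℝ) (K : V → V) (z v : V) :
    covDeriv G K z v = fderiv ℝ K z v + christoffelMap G z (K z) v := rfl

/-- The curvature `u ↦ R(u,v)w` of a field `G` of bilinear forms on a vector space. -/
def curvatureMap (G : V → V →L[ℝ] V →L[ℝ] ℝ) (z v w : V) : V →L[ℝ] V :=
  ((fderiv ℝ (christoffelMap G) z).flip w).flip v - fderiv ℝ (christoffelMap G) z v w
    + christoffelMap G z (christoffelMap G z w v)
    - ((christoffelMap G z).flip v).comp (christoffelMap G z w)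

theorem curvatureMap_apply (G : V → V →L[ℝ] V →L[ℝ] ℝ) (z u v w : V) :
    curvatureMap G z v w u =
      fderiv ℝ (christoffelMap G) z u w v - fderiv ℝ (christoffelMap G) z v w u
        + christoffelMap G z (christoffelMap G z w v) u
        - christoffelMap G z (christoffelMap G z w u) v := rfl

variable {G : V → V →L[ℝ] V →L[ℝ] ℝ} {z : V}

/-- Lowering the index removes the inverse metric. Identities between Christoffel symbols are
checked below in this form, by pairing with an arbitrary `w`. -/
theorem apply_christoffelMap (hG : (G z).IsInvertible) (v u w : V) :
    2 * G z (christoffelMap G z v u) w =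
      fderiv ℝ G z u v w + fderiv ℝ G z v u w - fderiv ℝ G z w v u := by
  obtain ⟨e, he⟩ := hG
  have h : ∀ L : V →L[ℝ] ℝ, G z ((G z).inverse L) = L := by
    intro L
    rw [← he, ContinuousLinearMap.inverse_equiv]
    simp
  simp only [christoffelMap, smul_apply, ContinuousLinearMap.comp_apply,
    ContinuousLinearMap.compL_apply, map_smul, h]
  simp

theorem fderiv_apply_symm (hG : DifferentiableAt ℝ G z)
    (hs : ∀ᶠ y in 𝓝 z, ∀ u v, G y u v = G y v u) (w u v : V) :
    fderiv ℝ G z w u v = fderiv ℝ G z w v u := by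
  have h : ∀ u v, HasFDerivAt (fun y ↦ G y u v) _ z := fun u v ↦
    (hG.hasFDerivAt.clm_apply (hasFDerivAt_const u z)).clm_apply (hasFDerivAt_const v z)
  simpa using congrArg (fun L : V →L[ℝ] ℝ ↦ L w)
    ((h u v).unique ((h v u).congr_of_eventuallyEq (hs.mono fun y hy ↦ hy u v)))

theorem christoffelMap_symm (hL : (G z).IsInvertible) (hG : DifferentiableAt ℝ G z)
    (hs : ∀ᶠ y in 𝓝 z, ∀ u v, G y u v = G y v u) (u v : V) :
    christoffelMap G z u v = christoffelMap G z v u := by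
  have hinj : Function.Injective (G z) := by
    obtain ⟨e, he⟩ := hL
    rw [← he]; exact e.injective
  apply hinj
  ext w
  have h1 := apply_christoffelMap hL u v w
  have h2 := apply_christoffelMap hL v u w
  rw [fderiv_apply_symm hG hs w v u] at h2
  linarith

theorem contDiffAt_christoffelMap [CompleteSpace V] {n m : WithTop ℕ∞} (hL : (G z).IsInvertible)
    (hG : ContDiffAt ℝ n G z) (hmn : m + 1 ≤ n) : ContDiffAt ℝ m (christoffelMap G) z := by
  have hd : ContDiffAt ℝ m (fderiv ℝ G) z := hG.fderiv_right hmn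
  have hi : ContDiffAt ℝ m (fun y ↦ (G y).inverse) z :=
    hL.contDiffAt_map_inverse.comp z (hG.of_le (le_trans le_self_add hmn))
  have hf : ContDiffAt ℝ m (fun y ↦ (fderiv ℝ G y).flip) z :=
    ((ContinuousLinearMap.flipₗᵢ ℝ V V (V →L[ℝ] ℝ)).toContinuousLinearEquiv.contDiff).contDiffAt.comp
      z hd
  refine ContDiffAt.const_smul _ (ContDiffAt.clm_comp ?_ ((hf.add hd).sub ?_))
  · exact (ContinuousLinearMap.compL ℝ V (V →L[ℝ] ℝ) V).contDiff.contDiffAt.comp z hi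
  · exact contDiffAt_const.clm_comp hf

/-- The transformation law of the covariant differential under a change of coordinates `τ`. -/
theorem covDeriv_pullback {G' : V → V →L[ℝ] V →L[ℝ] ℝ} {K K' : V → V} {τ : V → V}
    (hτ : ContDiffAt ℝ 2 τ z) (hiτ : Function.Surjective (fderiv ℝ τ z))
    (hL : (G z).IsInvertible) (hL' : (G' (τ z)).IsInvertible)
    (hG : DifferentiableAt ℝ G' (τ z))
    (hs : ∀ᶠ y in 𝓝 (τ z), ∀ u v, G' y u v = G' y v u)
    (hK : DifferentiableAt ℝ K z) (hK' : DifferentiableAt ℝ K' (τ z))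
    (hGG : ∀ᶠ y in 𝓝 z, ∀ u v, G y u v = G' (τ y) (fderiv ℝ τ y u) (fderiv ℝ τ y v))
    (hKK : ∀ᶠ y in 𝓝 z, K' (τ y) = fderiv ℝ τ y (K y)) (hGd : DifferentiableAt ℝ G z) (u : V) :
    fderiv ℝ τ z (covDeriv G K z u) = covDeriv G' K' (τ z) (fderiv ℝ τ z u) := by
  have hτd : DifferentiableAt ℝ τ z := hτ.differentiableAt (by norm_num)
  have hDτ : DifferentiableAt ℝ (fderiv ℝ τ) z :=
    (hτ.fderiv_right (m := 1) (by norm_num)).differentiableAt (by norm_num)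
  have hsymm := (hτ.isSymmSndFDerivAt (by simp)).eq
  have hinj' : Function.Injective (G' (τ z)) := by
    obtain ⟨e, he⟩ := hL'
    rw [← he]; exact e.injective
  have hs0 := hs.self_of_nhds
  set A := fderiv ℝ τ z with hA
  set D := fderiv ℝ (fderiv ℝ τ) z with hD
  -- Product rule for the pulled-back metric; the terms in `D` come from differentiating the
  -- Jacobian of `τ`.
  have hdG : ∀ c a b, fderiv ℝ G z c a b = fderiv ℝ G' (τ z) (A c) (A a) (A b)
      + G' (τ z) (D c a) (A b) + G' (τ z) (A a) (D c b) := by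
    intro c a b
    have h1 : HasFDerivAt (fun y ↦ G y a b) _ z :=
      (hGd.hasFDerivAt.clm_apply (hasFDerivAt_const a z)).clm_apply (hasFDerivAt_const b z)
    have h2 : HasFDerivAt (fun y ↦ G' (τ y) (fderiv ℝ τ y a) (fderiv ℝ τ y b)) _ z :=
      ((hG.hasFDerivAt.comp z hτd.hasFDerivAt).clm_apply
        (hDτ.hasFDerivAt.clm_apply (hasFDerivAt_const a z))).clm_apply
        (hDτ.hasFDerivAt.clm_apply (hasFDerivAt_const b z))
    have h3 := congrArg (fun L : V →L[ℝ] ℝ ↦ L c)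
      (h1.unique (h2.congr_of_eventuallyEq (hGG.mono fun y hy ↦ hy a b)))
    simp at h3
    rw [h3]
    simp only [← hA, ← hD]
    ring
  have hdK : fderiv ℝ K' (τ z) (A u) = D u (K z) + A (fderiv ℝ K z u) := by
    have h1 : HasFDerivAt (fun y ↦ K' (τ y)) _ z := hK'.hasFDerivAt.comp z hτd.hasFDerivAt
    have h2 := hDτ.hasFDerivAt.clm_apply hK.hasFDerivAt
    have h3 := congrArg (fun L : V →L[ℝ] V ↦ L u) (h1.unique (h2.congr_of_eventuallyEq hKK))
    simp at h3
    rw [hA, h3, add_comm]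
  -- The inhomogeneous term `D u v` is the one that appears in `hdK`, so the two cancel in the
  -- covariant derivative.
  have hΓ : ∀ v, A (christoffelMap G z v u) = D u v + christoffelMap G' (τ z) (A v) (A u) := by
    intro v
    apply hinj'
    ext w'
    obtain ⟨w, rfl⟩ := hiτ w'
    have e1 := apply_christoffelMap hL v u w
    have e2 := apply_christoffelMap hL' (A v) (A u) (A w)
    rw [hGG.self_of_nhds, ← hA, hdG, hdG, hdG] at e1
    rw [map_add, add_apply]
    -- By symmetry of `D` and `G'`, four of the six second-derivative terms cancel in pairs and the
    -- other two add up to `2 G' (D u v) (A w)`.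
    rw [hsymm v u, hsymm w v, hsymm w u, hs0 (A v), hs0 (A u)] at e1
    linarith
  rw [covDeriv_apply, covDeriv_apply, map_add, hΓ, hdK, hKK.self_of_nhds]
  abel

end CoordinateGeometry

/-! ### Raychaudhuri's inequality in coordinates -/

section CoordinateRaychaudhuri

variable {V : Type*} [NormedAddCommGroup V] [NormedSpace ℝ V]
variable {G : V → V →L[ℝ] V →L[ℝ] ℝ} {K : V → V} {z : V}

theorem differentiableAt_christoffelMap [CompleteSpace V] (hL : (G z).IsInvertible)
    (hG : ContDiffAt ℝ 2 G z) : DifferentiableAt ℝ (christoffelMap G) z :=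
  (contDiffAt_christoffelMap (m := 1) hL hG (by norm_num)).differentiableAt (by norm_num)

theorem hasFDerivAt_covDeriv [CompleteSpace V] (hL : (G z).IsInvertible) (hG : ContDiffAt ℝ 2 G z)
    (hK : ContDiffAt ℝ 2 K z) :
    HasFDerivAt (covDeriv G K) (fderiv ℝ (fderiv ℝ K) z +
      ((christoffelMap G z).comp (fderiv ℝ K z) +
        (fderiv ℝ (christoffelMap G) z).flip (K z))) z := by
  have hK1 : DifferentiableAt ℝ K z := hK.differentiableAt (by norm_num)
  have hK2 : DifferentiableAt ℝ (fderiv ℝ K) z :=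
    (hK.fderiv_right (m := 1) (by norm_num)).differentiableAt (by norm_num)
  exact hK2.hasFDerivAt.add
    ((differentiableAt_christoffelMap hL hG).hasFDerivAt.clm_apply hK1.hasFDerivAt)

theorem two_mul_apply_covDeriv (hL : (G z).IsInvertible) (v w : V) :
    2 * G z (covDeriv G K z v) w = 2 * G z (fderiv ℝ K z v) w + fderiv ℝ G z v (K z) w +
      fderiv ℝ G z (K z) v w - fderiv ℝ G z w (K z) v := by
  rw [covDeriv_apply, map_add, add_apply, mul_add, apply_christoffelMap hL]
  ring

variable [FiniteDimensional ℝ V]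

variable (V) in
/-- The trace of endomorphisms, as a continuous linear map. -/
def traceCLM : (V →L[ℝ] V) →L[ℝ] ℝ :=
  LinearMap.toContinuousLinearMap ((LinearMap.trace ℝ V).comp (ContinuousLinearMap.coeLM ℝ))

theorem traceCLM_apply (f : V →L[ℝ] V) : traceCLM V f = LinearMap.trace ℝ V f.toLinearMap := rfl

theorem traceCLM_comp_comm (f h : V →L[ℝ] V) : traceCLM V (f.comp h) = traceCLM V (h.comp f) :=
  LinearMap.trace_mul_comm ℝ f.toLinearMap h.toLinearMap

/-- The contracted Ricci identity `∇_b (kᵃ ∇_a kᵇ) = kᵃ ∇_a (∇_b kᵇ) + R_ab kᵃ kᵇ + ∇_a kᵇ ∇_b kᵃ`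
at a point where `kᵃ ∇_a kᵇ = 0`. -/
theorem trace_fderiv_acceleration (hL : (G z).IsInvertible) (hG : ContDiffAt ℝ 2 G z)
    (hs : ∀ᶠ y in 𝓝 z, ∀ u v, G y u v = G y v u) (hK : ContDiffAt ℝ 2 K z)
    (hgeo : covDeriv G K z (K z) = 0) :
    traceCLM V (fderiv ℝ (fun y ↦ covDeriv G K y (K y)) z) =
      traceCLM V (fderiv ℝ (covDeriv G K) z (K z)) + traceCLM V (curvatureMap G z (K z) (K z)) +
        traceCLM V ((covDeriv G K z).comp (covDeriv G K z)) := by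
  have hB := hasFDerivAt_covDeriv hL hG hK
  have hK1 : DifferentiableAt ℝ K z := hK.differentiableAt (by norm_num)
  have hΓ := christoffelMap_symm hL (hG.differentiableAt (by norm_num)) hs
  have hsymm := (hK.isSymmSndFDerivAt (by simp)).eq
  -- The identity holds before taking traces, up to the commutator of the Christoffel term with
  -- `∇K`, which is traceless.
  have key : fderiv ℝ (fun y ↦ covDeriv G K y (K y)) z =
      fderiv ℝ (covDeriv G K) z (K z) + curvatureMap G z (K z) (K z) +
        (covDeriv G K z).comp (covDeriv G K z) +
        ((christoffelMap G z (K z)).comp (covDeriv G K z) -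
          (covDeriv G K z).comp (christoffelMap G z (K z))) := by
    rw [(hB.clm_apply hK1.hasFDerivAt).fderiv, hB.fderiv]
    ext u
    have hDK : ∀ v, fderiv ℝ K z v = covDeriv G K z v - christoffelMap G z (K z) v := fun v ↦ by
      rw [covDeriv_apply]; abel
    simp only [add_apply, sub_apply, ContinuousLinearMap.comp_apply,
      ContinuousLinearMap.flip_apply, curvatureMap_apply, hsymm u, hDK, map_sub, hgeo, map_zero, zero_apply,
      hΓ (K z) (covDeriv G K z u)]
    abel
  rw [key]
  simp only [map_add, map_sub, traceCLM_comp_comm (christoffelMap G z (K z))]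
  ring

/-- By metric compatibility the left side is half the derivative of `g(K,K)` along `v`, which is
zero as `K` is null near `z`. -/
theorem apply_covDeriv_of_null (hL : IsLorentzianForm (G z)) (hG : DifferentiableAt ℝ G z)
    (hs : ∀ᶠ y in 𝓝 z, ∀ u v, G y u v = G y v u) (hK : DifferentiableAt ℝ K z)
    (hnull : ∀ᶠ y in 𝓝 z, G y (K y) (K y) = 0) (v : V) : G z (covDeriv G K z v) (K z) = 0 := by
  have h1 : HasFDerivAt (fun y ↦ G y (K y) (K y)) _ z :=
    (hG.hasFDerivAt.clm_apply hK.hasFDerivAt).clm_apply hK.hasFDerivAt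
  have h2 := congrArg (fun L : V →L[ℝ] ℝ ↦ L v)
    (h1.unique ((hasFDerivAt_const (0 : ℝ) z).congr_of_eventuallyEq hnull))
  simp at h2
  have h3 := two_mul_apply_covDeriv (K := K) hL.isInvertible v (K z)
  rw [fderiv_apply_symm hG hs (K z) v] at h3
  rw [hL.symm (K z)] at h2
  linarith

/-- A vector field orthogonal to an immersed hypersurface is free of twist there. -/
theorem apply_covDeriv_symm {W : Type*} [NormedAddCommGroup W] [NormedSpace ℝ W] {f : W → V} {q : W}
    (hL : IsLorentzianForm (G (f q))) (hG : DifferentiableAt ℝ G (f q))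
    (hs : ∀ᶠ y in 𝓝 (f q), ∀ u v, G y u v = G y v u) (hK : DifferentiableAt ℝ K (f q))
    (hf : ContDiffAt ℝ 2 f q)
    (horth : ∀ᶠ p in 𝓝 q, ∀ v, G (f p) (K (f p)) (fderiv ℝ f p v) = 0) (a b : W) :
    G (f q) (covDeriv G K (f q) (fderiv ℝ f q a)) (fderiv ℝ f q b) =
      G (f q) (covDeriv G K (f q) (fderiv ℝ f q b)) (fderiv ℝ f q a) := by
  have hf1 : HasFDerivAt f _ q := (hf.differentiableAt (by norm_num)).hasFDerivAt
  have hf2 : DifferentiableAt ℝ (fderiv ℝ f) q :=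
    (hf.fderiv_right (m := 1) (by norm_num)).differentiableAt (by norm_num)
  have hsymm := (hf.isSymmSndFDerivAt (by simp)).eq
  -- The relation `g(K, Df b) = 0` is differentiated along `a`. The second derivative of `f` is
  -- symmetric in `a` and `b` and drops out when they are exchanged and the results subtracted.
  have hd : ∀ a b, fderiv ℝ G (f q) (fderiv ℝ f q a) (K (f q)) (fderiv ℝ f q b) +
      G (f q) (fderiv ℝ K (f q) (fderiv ℝ f q a)) (fderiv ℝ f q b) +
      G (f q) (K (f q)) (fderiv ℝ (fderiv ℝ f) q a b) = 0 := by
    intro a b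
    have h1 : HasFDerivAt (fun p ↦ G (f p) (K (f p)) (fderiv ℝ f p b)) _ q :=
      ((hG.hasFDerivAt.comp q hf1).clm_apply (hK.hasFDerivAt.comp q hf1)).clm_apply
        (hf2.hasFDerivAt.clm_apply (hasFDerivAt_const b q))
    have h2 := congrArg (fun L : W →L[ℝ] ℝ ↦ L a)
      (h1.unique ((hasFDerivAt_const (0 : ℝ) q).congr_of_eventuallyEq (horth.mono fun p hp ↦ hp b)))
    simp at h2
    linarith
  have e1 := hd a b
  have e2 := hd b a
  rw [hsymm b a] at e2
  have e3 := two_mul_apply_covDeriv (K := K) hL.isInvertible (fderiv ℝ f q a) (fderiv ℝ f q b)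
  have e4 := two_mul_apply_covDeriv (K := K) hL.isInvertible (fderiv ℝ f q b) (fderiv ℝ f q a)
  rw [fderiv_apply_symm hG hs (K (f q))] at e3
  linarith

/-- Raychaudhuri's inequality along a null hypersurface: `kᵃ ∇_a θ ≤ -R_ab kᵃ kᵇ`. -/
theorem fderiv_trace_covDeriv_le {W : Type*} [NormedAddCommGroup W] [NormedSpace ℝ W]
    [FiniteDimensional ℝ W] {f : W → V} {q : W}
    (hdim : Module.finrank ℝ W + 1 = Module.finrank ℝ V)
    (hL : ∀ᶠ y in 𝓝 (f q), IsLorentzianForm (G y)) (hG : ContDiffAt ℝ 2 G (f q))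
    (hK : ContDiffAt ℝ 2 K (f q)) (hnull : ∀ᶠ y in 𝓝 (f q), G y (K y) (K y) = 0)
    (hK0 : K (f q) ≠ 0) (hf : ContDiffAt ℝ 2 f q) (hinj : Function.Injective (fderiv ℝ f q))
    (hgeo : ∀ᶠ p in 𝓝 q, covDeriv G K (f p) (K (f p)) = 0)
    (horth : ∀ᶠ p in 𝓝 q, ∀ v, G (f p) (K (f p)) (fderiv ℝ f p v) = 0) :
    traceCLM V (fderiv ℝ (covDeriv G K) (f q) (K (f q))) ≤
      -traceCLM V (curvatureMap G (f q) (K (f q)) (K (f q))) := by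
  set z := f q with hz
  have hLz := hL.self_of_nhds
  have hs : ∀ᶠ y in 𝓝 z, ∀ u v, G y u v = G y v u := hL.mono fun y hy ↦ hy.symm
  have hG1 : DifferentiableAt ℝ G z := hG.differentiableAt (by norm_num)
  have hK1 : DifferentiableAt ℝ K z := hK.differentiableAt (by norm_num)
  have hnz := hnull.self_of_nhds
  have hgz : covDeriv G K z (K z) = 0 := hgeo.self_of_nhds
  -- The tangent space of the hypersurface is contained in `k^⊥` and both have codimension one, so
  -- they agree.
  have hrange : ∀ v, G z (K z) v = 0 → ∃ a, fderiv ℝ f q a = v := by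
    have hle : LinearMap.range (fderiv ℝ f q).toLinearMap ≤ LinearMap.ker (G z (K z)).toLinearMap := by
      rintro _ ⟨a, rfl⟩
      exact horth.self_of_nhds a
    have h1 := LinearMap.finrank_range_of_inj (f := (fderiv ℝ f q).toLinearMap) hinj
    have h2 := (G z (K z)).toLinearMap.finrank_range_add_finrank_ker
    have h3 : (G z (K z)).toLinearMap.range = ⊤ := by
      rw [LinearMap.range_eq_top]
      obtain ⟨t, ht, -⟩ := hLz.exists_ne_zero hnz hK0
      exact LinearMap.surjective (f := (G z (K z)).toLinearMap) fun h0 ↦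
        ht (congrArg (fun L : V →ₗ[ℝ] ℝ ↦ L t) h0)
    rw [h3, finrank_top, Module.finrank_self] at h2
    have h4 := Submodule.eq_of_le_of_finrank_eq hle (by omega)
    intro v hv
    have : v ∈ LinearMap.ker (G z (K z)).toLinearMap := hv
    rw [← h4] at this
    exact this
  have hnn : 0 ≤ traceCLM V ((covDeriv G K z).comp (covDeriv G K z)) := by
    refine hLz.trace_comp_self_nonneg (B := (covDeriv G K z).toLinearMap) hnz hK0 hgz
      (apply_covDeriv_of_null hLz hG1 hs hK1 hnull) fun v w hv hw ↦ ?_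
    obtain ⟨a, rfl⟩ := hrange v hv
    obtain ⟨b, rfl⟩ := hrange w hw
    exact apply_covDeriv_symm hLz hG1 hs hK1 hf horth a b
  have hacc : HasFDerivAt (fun y ↦ covDeriv G K y (K y)) _ z :=
    (hasFDerivAt_covDeriv hLz.isInvertible hG hK).differentiableAt.hasFDerivAt.clm_apply
      hK1.hasFDerivAt
  have hf1 : HasFDerivAt f _ q := (hf.differentiableAt (by norm_num)).hasFDerivAt
  -- The acceleration vanishes along the hypersurface, so its derivative kills `k^⊥`. It is
  -- orthogonal to `K` on a whole neighbourhood, since `K` is null there; differentiating this where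
  -- the acceleration is zero puts the values of the derivative in `k^⊥`.
  have hdiv : traceCLM V (fderiv ℝ (fun y ↦ covDeriv G K y (K y)) z) = 0 := by
    refine IsLorentzianForm.trace_eq_zero_of_isNilpotent (g := G z) (k := K z) ?_ ?_
    · intro v hv
      obtain ⟨a, rfl⟩ := hrange v hv
      have h1 := hacc.differentiableAt.hasFDerivAt.comp q hf1
      have h2 := h1.unique ((hasFDerivAt_const (0 : V) q).congr_of_eventuallyEq hgeo)
      exact congrArg (fun L : W →L[ℝ] V ↦ L a) h2
    · intro v
      have hG2 : ∀ᶠ y in 𝓝 z, ContDiffAt ℝ 2 G y := hG.eventually (by simp)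
      have hK2 : ∀ᶠ y in 𝓝 z, ContDiffAt ℝ 2 K y := hK.eventually (by simp)
      have h0 : ∀ᶠ y in 𝓝 z, G y (K y) (covDeriv G K y (K y)) = 0 := by
        filter_upwards [hL, hG2, hK2, hs.eventually_nhds, hnull.eventually_nhds]
          with y h1 h2 h3 h4 h5
        rw [h1.symm]
        exact apply_covDeriv_of_null h1 (h2.differentiableAt (by norm_num)) h4
          (h3.differentiableAt (by norm_num)) h5 _
      have h1 : HasFDerivAt (fun y ↦ G y (K y) (covDeriv G K y (K y))) _ z :=
        (hG1.hasFDerivAt.clm_apply hK1.hasFDerivAt).clm_apply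
          hacc.differentiableAt.hasFDerivAt
      have h2 := congrArg (fun L : V →L[ℝ] ℝ ↦ L v)
        (h1.unique ((hasFDerivAt_const (0 : ℝ) z).congr_of_eventuallyEq h0))
      simpa [hgz] using h2
  have := trace_fderiv_acceleration hLz.isInvertible hG hs hK hgz
  linarith

end CoordinateRaychaudhuri

/-! ### Tangent vectors and vector fields in a fixed chart -/

section Charts

variable {M : Type*} [TopologicalSpace M] [ChartedSpace E4 M] [IsManifold (𝓡 4) ∞ M]

/-- The linear map that sends components in the preferred chart at `x` to tangent vectors
at `y`. -/
def fromChart (x y : M) : E4 →L[ℝ] E4 := tangentCoordChange (𝓡 4) x y y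

/-- The components of a vector field in the preferred chart at `x`. -/
def chartField (x : M) (Y : Π y : M, TangentSpace (𝓡 4) y) (z : E4) : E4 :=
  chartRep x Y ((extChartAt (𝓡 4) x).symm z)

/-- The metric in the preferred chart at `x`. -/
def LorentzMetric.chartMetric (g : LorentzMetric M) (x : M) (z : E4) : E4 →L[ℝ] E4 →L[ℝ] ℝ :=
  ContinuousLinearMap.bilinearComp (E := E4) (F := E4) (E' := E4) (F' := E4)
    (g.form ((extChartAt (𝓡 4) x).symm z))
    (fromChart x ((extChartAt (𝓡 4) x).symm z)) (fromChart x ((extChartAt (𝓡 4) x).symm z))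

theorem LorentzMetric.chartMetric_apply (g : LorentzMetric M) (x : M) (z u v : E4) :
    g.chartMetric x z u v = g.form ((extChartAt (𝓡 4) x).symm z)
      (fromChart x ((extChartAt (𝓡 4) x).symm z) u)
      (fromChart x ((extChartAt (𝓡 4) x).symm z) v) := rfl

theorem fromChart_self (x : M) : fromChart x x = ContinuousLinearMap.id ℝ E4 := by
  ext1 v
  exact tangentCoordChange_self (mem_extChartAt_source x)

theorem chartRep_eq (x y : M) (Y : Π y : M, TangentSpace (𝓡 4) y) :
    chartRep x Y y = tangentCoordChange (𝓡 4) y x y (Y y) := rfl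

theorem tangentCoordChange_fromChart {x y : M} (hy : y ∈ (extChartAt (𝓡 4) x).source) (v : E4) :
    tangentCoordChange (𝓡 4) y x y (fromChart x y v) = v := by
  rw [fromChart, tangentCoordChange_comp ⟨⟨hy, mem_extChartAt_source y⟩, hy⟩]
  exact tangentCoordChange_self hy

theorem fromChart_tangentCoordChange {x y : M} (hy : y ∈ (extChartAt (𝓡 4) x).source) (v : E4) :
    fromChart x y (tangentCoordChange (𝓡 4) y x y v) = v := by
  have h := mem_extChartAt_source (I := 𝓡 4) y
  rw [fromChart, tangentCoordChange_comp ⟨⟨h, hy⟩, h⟩]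
  exact tangentCoordChange_self h

theorem fromChart_chartRep {x y : M} (hy : y ∈ (extChartAt (𝓡 4) x).source)
    (Y : Π y : M, TangentSpace (𝓡 4) y) : fromChart x y (chartRep x Y y) = Y y :=
  fromChart_tangentCoordChange hy _

/-- The isomorphism between components in the preferred chart at `x` and tangent vectors at `y`. -/
def fromChartEquiv {x y : M} (hy : y ∈ (extChartAt (𝓡 4) x).source) : E4 ≃ₗ[ℝ] E4 where
  __ := (fromChart x y).toLinearMap
  invFun := tangentCoordChange (𝓡 4) y x y
  left_inv := tangentCoordChange_fromChart hy
  right_inv := fromChart_tangentCoordChange hy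

theorem fderiv_chartTransition (x y y' : M) :
    fderiv ℝ (extChartAt (𝓡 4) y ∘ (extChartAt (𝓡 4) x).symm) (extChartAt (𝓡 4) x y') =
      tangentCoordChange (𝓡 4) x y y' := by
  rw [tangentCoordChange_def, ModelWithCorners.range_eq_univ, fderivWithin_univ]

theorem contDiffAt_chartTransition {x y y' : M} (hx : y' ∈ (extChartAt (𝓡 4) x).source)
    (hy : y' ∈ (extChartAt (𝓡 4) y).source) :
    ContDiffAt ℝ ∞ (extChartAt (𝓡 4) y ∘ (extChartAt (𝓡 4) x).symm) (extChartAt (𝓡 4) x y') := by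
  have h : extChartAt (𝓡 4) x y' ∈
      ((extChartAt (𝓡 4) x).symm ≫ (extChartAt (𝓡 4) y)).source := by
    rw [PartialEquiv.trans_source'', PartialEquiv.symm_symm, PartialEquiv.symm_target]
    exact Set.mem_image_of_mem _ ⟨hx, hy⟩
  have := contDiffWithinAt_ext_coord_change (n := ∞) (I := 𝓡 4) y x h
  rwa [ModelWithCorners.range_eq_univ, contDiffWithinAt_univ] at this

/-- The extension is the inverse trivialization applied to a constant, and the trivialization at `x`
is the identity on the fibre over `x`. -/
theorem chartRep_extend {x y : M} (hy : y ∈ (extChartAt (𝓡 4) x).source)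
    (v : TangentSpace (𝓡 4) x) : chartRep x (FiberBundle.extend E4 v) y = v := by
  have hb : y ∈ (trivializationAt E4 (TangentSpace (𝓡 4) : M → Type) x).baseSet := by
    rwa [TangentBundle.trivializationAt_baseSet, ← extChartAt_source (𝓡 4)]
  have h2 : (trivializationAt E4 (TangentSpace (𝓡 4) : M → Type) x ⟨x, v⟩).2 = v := by
    have h3 := chartRep_self x (FiberBundle.extend E4 v)
    simp only [chartRep, FiberBundle.extend_apply_self] at h3
    exact h3
  rw [chartRep, FiberBundle.extend, Bundle.Trivialization.apply_mk_symm _ hb]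
  exact h2

theorem extend_eq_fromChart {x y : M} (hy : y ∈ (extChartAt (𝓡 4) x).source)
    (v : TangentSpace (𝓡 4) x) :
    (FiberBundle.extend E4 v : Π y : M, TangentSpace (𝓡 4) y) y = fromChart x y v := by
  rw [← fromChart_chartRep hy (FiberBundle.extend E4 v), chartRep_extend hy]

theorem contMDiffAt_extend_of_mem {x y : M} (hy : y ∈ (extChartAt (𝓡 4) x).source)
    (v : TangentSpace (𝓡 4) x) : ContMDiffAt (𝓡 4) ((𝓡 4).prod 𝓘(ℝ, E4)) ∞
      (fun y ↦ (⟨y, FiberBundle.extend E4 v y⟩ : TangentBundle (𝓡 4) M)) y := by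
  refine ((trivializationAt E4 (TangentSpace (𝓡 4) : M → Type) x).contMDiffAt_section_iff ?_).2 ?_
  · rwa [TangentBundle.trivializationAt_baseSet, ← extChartAt_source (𝓡 4)]
  · refine (contMDiffAt_const (I' := 𝓘(ℝ, E4)) (M' := E4) (c := v)).congr_of_eventuallyEq ?_
    filter_upwards [(isOpen_extChartAt_source x).mem_nhds hy] with y' hy'
    exact chartRep_extend hy' v

theorem contDiffAt_comp_symm {F : Type*} [NormedAddCommGroup F] [NormedSpace ℝ F] {n : WithTop ℕ∞}
    (hn : n ≤ ∞) {f : M → F} {x y : M} (hy : y ∈ (extChartAt (𝓡 4) x).source)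
    (hf : ContMDiffAt (𝓡 4) 𝓘(ℝ, F) n f y) :
    ContDiffAt ℝ n (f ∘ (extChartAt (𝓡 4) x).symm) (extChartAt (𝓡 4) x y) := by
  rw [← contMDiffAt_iff_contDiffAt]
  refine ContMDiffAt.comp (I' := 𝓡 4) _ ?_ ?_
  · rwa [(extChartAt (𝓡 4) x).left_inv hy]
  · have h := (contMDiffOn_extChartAt_symm (I := 𝓡 4) (n := ∞) x).of_le hn
    exact h.contMDiffAt ((isOpen_extChartAt_target x).mem_nhds ((extChartAt (𝓡 4) x).map_source hy))

theorem contDiffAt_chartField {n : WithTop ℕ∞} (hn : n ≤ ∞) {Y : Π y : M, TangentSpace (𝓡 4) y}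
    {x y : M} (hy : y ∈ (extChartAt (𝓡 4) x).source)
    (hY : ContMDiffAt (𝓡 4) ((𝓡 4).prod 𝓘(ℝ, E4)) n
      (fun y ↦ (⟨y, Y y⟩ : TangentBundle (𝓡 4) M)) y) :
    ContDiffAt ℝ n (chartField x Y) (extChartAt (𝓡 4) x y) := by
  have : ContMDiffVectorBundle n E4 (TangentSpace (𝓡 4) : M → Type) (𝓡 4) :=
    ContMDiffVectorBundle.of_le hn
  refine contDiffAt_comp_symm hn hy
    (((trivializationAt E4 (TangentSpace (𝓡 4) : M → Type) x).contMDiffAt_section_iff ?_).1 hY)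
  rwa [TangentBundle.trivializationAt_baseSet, ← extChartAt_source (𝓡 4)]

theorem differentiableAt_comp_symm {F : Type*} [NormedAddCommGroup F] [NormedSpace ℝ F]
    {f : M → F} {x y : M} (hy : y ∈ (extChartAt (𝓡 4) x).source)
    (hf : MDifferentiableAt (𝓡 4) 𝓘(ℝ, F) f y) :
    DifferentiableAt ℝ (f ∘ (extChartAt (𝓡 4) x).symm) (extChartAt (𝓡 4) x y) := by
  rw [← mdifferentiableAt_iff_differentiableAt]
  refine MDifferentiableAt.comp (I' := 𝓡 4) _ ?_ ?_
  · rwa [(extChartAt (𝓡 4) x).left_inv hy]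
  · exact (mdifferentiableOn_extChartAt_symm (I := 𝓡 4) (x := x)).mdifferentiableAt
      ((isOpen_extChartAt_target x).mem_nhds ((extChartAt (𝓡 4) x).map_source hy))

theorem mdifferentiableAt_of_comp_symm {F : Type*} [NormedAddCommGroup F] [NormedSpace ℝ F]
    {f : M → F} {x y : M} (hy : y ∈ (extChartAt (𝓡 4) x).source)
    (hf : DifferentiableAt ℝ (f ∘ (extChartAt (𝓡 4) x).symm) (extChartAt (𝓡 4) x y)) :
    MDifferentiableAt (𝓡 4) 𝓘(ℝ, F) f y := by
  have h1 : MDifferentiableAt (𝓡 4) 𝓘(ℝ, E4) (extChartAt (𝓡 4) x) y :=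
    mdifferentiableAt_extChartAt (by rwa [← extChartAt_source (𝓡 4)])
  refine ((mdifferentiableAt_iff_differentiableAt.2 hf).comp y h1).congr_of_eventuallyEq ?_
  filter_upwards [(isOpen_extChartAt_source x).mem_nhds hy] with y' hy'
  simp only [Function.comp_apply, (extChartAt (𝓡 4) x).left_inv hy']

theorem differentiableAt_chartField {Y : Π y : M, TangentSpace (𝓡 4) y}
    {x y : M} (hy : y ∈ (extChartAt (𝓡 4) x).source)
    (hY : MDifferentiableAt (𝓡 4) ((𝓡 4).prod 𝓘(ℝ, E4))
      (fun y ↦ (⟨y, Y y⟩ : TangentBundle (𝓡 4) M)) y) :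
    DifferentiableAt ℝ (chartField x Y) (extChartAt (𝓡 4) x y) := by
  refine differentiableAt_comp_symm hy
    (((trivializationAt E4 (TangentSpace (𝓡 4) : M → Type) x).mdifferentiableAt_section_iff
      (𝓡 4) Y ?_).1 hY)
  rwa [TangentBundle.trivializationAt_baseSet, ← extChartAt_source (𝓡 4)]

theorem mdifferentiableAt_of_chartField {Y : Π y : M, TangentSpace (𝓡 4) y}
    {x y : M} (hy : y ∈ (extChartAt (𝓡 4) x).source)
    (hY : DifferentiableAt ℝ (chartField x Y) (extChartAt (𝓡 4) x y)) :
    MDifferentiableAt (𝓡 4) ((𝓡 4).prod 𝓘(ℝ, E4))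
      (fun y ↦ (⟨y, Y y⟩ : TangentBundle (𝓡 4) M)) y := by
  refine ((trivializationAt E4 (TangentSpace (𝓡 4) : M → Type) x).mdifferentiableAt_section_iff
      (𝓡 4) Y ?_).2 (mdifferentiableAt_of_comp_symm hy hY)
  rwa [TangentBundle.trivializationAt_baseSet, ← extChartAt_source (𝓡 4)]

-- At the base point of the chart, tangent vectors are already identified with their components, so
-- no change of coordinates enters.
omit [IsManifold (𝓡 4) ∞ M] in
theorem mvfderiv_apply_eq_fderiv {F : Type*} [NormedAddCommGroup F] [NormedSpace ℝ F]
    {f : M → F} {x : M} (hf : MDifferentiableAt (𝓡 4) 𝓘(ℝ, F) f x) (v : TangentSpace (𝓡 4) x) :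
    mvfderiv (𝓡 4) f x v =
      fderiv ℝ (f ∘ (extChartAt (𝓡 4) x).symm) (extChartAt (𝓡 4) x x) v := by
  have h : ∀ (h : E4 → F) (L : E4 →L[ℝ] F) (z : E4),
      HasFDerivWithinAt h L (Set.range (𝓡 4)) z → fderiv ℝ h z = L := by
    intro h L z hL
    rw [ModelWithCorners.range_eq_univ, hasFDerivWithinAt_univ] at hL
    exact hL.fderiv
  exact congrArg (fun L : E4 →L[ℝ] F ↦ L v) (h _ _ _ hf.hasMFDerivAt.2).symm

end Charts

/-! ### The metric and its Christoffel symbols in a chart -/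

section ChartLeviCivita

variable {M : Type*} [TopologicalSpace M] [ChartedSpace E4 M] [IsManifold (𝓡 4) ∞ M]

theorem clm_ext_single {F : Type*} [NormedAddCommGroup F] [NormedSpace ℝ F] {A B : E4 →L[ℝ] F}
    (h : ∀ i, A (EuclideanSpace.single i 1) = B (EuclideanSpace.single i 1)) : A = B := by
  have h2 : (A : E4 →ₗ[ℝ] F) = B :=
    (EuclideanSpace.basisFun (Fin 4) ℝ).toBasis.ext fun i ↦ by simpa using h i
  ext v
  exact congrArg (fun L : E4 →ₗ[ℝ] F ↦ L v) h2

namespace LorentzMetric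

variable (g : LorentzMetric M)

theorem chartMetric_extChartAt {x y : M} (hy : y ∈ (extChartAt (𝓡 4) x).source) (u v : E4) :
    g.chartMetric x (extChartAt (𝓡 4) x y) u v =
      g.form y (fromChart x y u) (fromChart x y v) := by
  have h : ∀ y' : M, y' = y → g.form y' (fromChart x y' u) (fromChart x y' v) =
      g.form y (fromChart x y u) (fromChart x y v) := by
    rintro _ rfl; rfl
  exact h _ ((extChartAt (𝓡 4) x).left_inv hy)

theorem chartMetric_self (x : M) (u v : E4) :
    g.chartMetric x (extChartAt (𝓡 4) x x) u v = g.form x u v := by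
  rw [chartMetric_extChartAt g (mem_extChartAt_source x), fromChart_self]
  rfl

theorem isLorentzianForm_chartMetric {x : M} {z : E4} (hz : z ∈ (extChartAt (𝓡 4) x).target) :
    IsLorentzianForm (g.chartMetric x z) := by
  have hy := (extChartAt (𝓡 4) x).map_target hz
  set y := (extChartAt (𝓡 4) x).symm z with hydef
  constructor
  · intro u v
    exact g.symm y _ _
  · obtain ⟨t, ht, htp⟩ := g.lorentzian y
    have e : fromChart x y ((fromChartEquiv hy).symm t) = t := (fromChartEquiv hy).apply_symm_apply t
    refine ⟨(fromChartEquiv hy).symm t, ?_, fun v hv hv0 ↦ ?_⟩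
    · rw [chartMetric_apply, ← hydef, e]
      exact ht
    · rw [chartMetric_apply, ← hydef, e] at hv
      exact htp _ hv fun h ↦ hv0 ((fromChartEquiv hy).map_eq_zero_iff.1 h)

theorem contMDiffAt_form_extend {x y : M} (hy : y ∈ (extChartAt (𝓡 4) x).source)
    (u v : TangentSpace (𝓡 4) x) : ContMDiffAt (𝓡 4) 𝓘(ℝ, ℝ) ∞
      (fun y ↦ g.form y (FiberBundle.extend E4 u y) (FiberBundle.extend E4 v y)) y := by
  have h := ContMDiffAt.clm_bundle_apply₂ (E₃ := Bundle.Trivial M ℝ) (F₃ := ℝ) (b := fun y : M ↦ y)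
    (g.smooth y) (contMDiffAt_extend_of_mem hy u) (contMDiffAt_extend_of_mem hy v)
  rw [Bundle.contMDiffAt_totalSpace] at h
  exact h.2

theorem chartMetric_eq_form_extend {x : M} {z : E4} (hz : z ∈ (extChartAt (𝓡 4) x).target)
    (u v : TangentSpace (𝓡 4) x) : g.chartMetric x z u v =
      ((fun y ↦ g.form y (FiberBundle.extend E4 u y)
        (FiberBundle.extend E4 v y)) ∘ (extChartAt (𝓡 4) x).symm) z := by
  have hy := (extChartAt (𝓡 4) x).map_target hz
  rw [Function.comp_apply, extend_eq_fromChart hy, extend_eq_fromChart hy]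
  rfl

/-- In finite dimension, smoothness of a field of forms can be tested on fixed vectors, that is, on
vector fields with constant components. -/
theorem contDiffAt_chartMetric {x : M} {z : E4} (hz : z ∈ (extChartAt (𝓡 4) x).target) :
    ContDiffAt ℝ ∞ (g.chartMetric x) z := by
  have h : ContDiffOn ℝ ∞ (g.chartMetric x) (extChartAt (𝓡 4) x).target := by
    rw [contDiffOn_clm_apply]
    intro u
    rw [contDiffOn_clm_apply]
    intro v z hz
    have h1 := contDiffAt_comp_symm le_rfl ((extChartAt (𝓡 4) x).map_target hz)
      (g.contMDiffAt_form_extend ((extChartAt (𝓡 4) x).map_target hz) u v)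
    rw [(extChartAt (𝓡 4) x).right_inv hz] at h1
    exact h1.contDiffWithinAt.congr_of_mem
      (fun z' hz' ↦ g.chartMetric_eq_form_extend hz' u v) hz
  exact h.contDiffAt ((isOpen_extChartAt_target x).mem_nhds hz)

theorem eventually_chartMetric_symm {x : M} {z : E4} (hz : z ∈ (extChartAt (𝓡 4) x).target) :
    ∀ᶠ z' in 𝓝 z, ∀ u v, g.chartMetric x z' u v = g.chartMetric x z' v u :=
  Filter.eventually_of_mem ((isOpen_extChartAt_target x).mem_nhds hz) fun _ hz' ↦
    (g.isLorentzianForm_chartMetric hz').symm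

theorem differentiableAt_chartMetric {x : M} {z : E4} (hz : z ∈ (extChartAt (𝓡 4) x).target) :
    DifferentiableAt ℝ (g.chartMetric x) z :=
  (g.contDiffAt_chartMetric hz).differentiableAt (by simp)

theorem gram_eq (x : M) (i j : Fin 4) : g.gram x i j =
    g.chartMetric x (extChartAt (𝓡 4) x x) (EuclideanSpace.single i 1)
      (EuclideanSpace.single j 1) := by
  rw [chartMetric_self]
  rfl

theorem dGram_eq (x : M) (l i j : Fin 4) : g.dGram x l i j =
    fderiv ℝ (g.chartMetric x) (extChartAt (𝓡 4) x x) (EuclideanSpace.single l 1)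
      (EuclideanSpace.single i 1) (EuclideanSpace.single j 1) := by
  have hz := mem_extChartAt_target (I := 𝓡 4) x
  have h1 : HasFDerivAt (fun z ↦ g.chartMetric x z (EuclideanSpace.single i 1)
      (EuclideanSpace.single j 1)) _ (extChartAt (𝓡 4) x x) :=
    ((g.differentiableAt_chartMetric hz).hasFDerivAt.clm_apply
      (hasFDerivAt_const _ _)).clm_apply (hasFDerivAt_const _ _)
  have h2 : (fun z ↦ g.chartMetric x z (EuclideanSpace.single i 1) (EuclideanSpace.single j 1))
      =ᶠ[𝓝 (extChartAt (𝓡 4) x x)] ((fun y ↦ g.form y (coordField x i y) (coordField x j y)) ∘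
        (extChartAt (𝓡 4) x).symm) :=
    Filter.eventually_of_mem ((isOpen_extChartAt_target x).mem_nhds hz) fun z' hz' ↦
      g.chartMetric_eq_form_extend hz' _ _
  have h3 := mvfderiv_apply_eq_fderiv
    (f := fun y ↦ g.form y (coordField x i y) (coordField x j y))
    ((g.contMDiffAt_form_extend (mem_extChartAt_source x) _ _).mdifferentiableAt (by simp))
    (coordVec x l)
  rw [dGram, h3, ← h2.fderiv_eq, h1.fderiv]
  simp [coordVec]

theorem isUnit_det_gram (x : M) : IsUnit (g.gram x).det := by
  have hL := g.isLorentzianForm_chartMetric (mem_extChartAt_target (I := 𝓡 4) x)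
  rw [isUnit_iff_ne_zero]
  intro h
  obtain ⟨v, hv, hv0⟩ := Matrix.exists_vecMul_eq_zero_iff.2 h
  apply hv
  have : (∑ i, v i • EuclideanSpace.single i (1 : ℝ) : E4) = 0 := by
    apply hL.eq_zero_of_forall
    intro w
    refine congrArg (fun L : E4 →L[ℝ] ℝ ↦ L w) (a₂ := 0) (clm_ext_single fun j ↦ ?_)
    have := congrFun hv0 j
    simp only [Matrix.vecMul, dotProduct, gram_eq, Pi.zero_apply] at this
    simpa using this
  ext i
  have h2 := congrArg (fun w : E4 ↦ w i) this
  simpa [Finset.sum_apply, Pi.single_apply] using h2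

/-- Both sides are compared on basis vectors after lowering the index, where the inverse Gram matrix
cancels against the Gram matrix. -/
theorem christoffelForm_eq (x : M) (w v : E4) :
    (g.christoffelForm x w v : E4) =
      christoffelMap (g.chartMetric x) (extChartAt (𝓡 4) x x) w v := by
  have hz := mem_extChartAt_target (I := 𝓡 4) x
  have hL := g.isLorentzianForm_chartMetric hz
  let C : E4 →L[ℝ] E4 →L[ℝ] E4 := ∑ m, ∑ i, ∑ j, (EuclideanSpace.proj j : E4 →L[ℝ] ℝ).smulRight
    ((EuclideanSpace.proj i : E4 →L[ℝ] ℝ).smulRight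
      (g.christoffel x m i j • (EuclideanSpace.single m 1 : E4)))
  have key : C = christoffelMap (g.chartMetric x) (extChartAt (𝓡 4) x x) := by
    refine clm_ext_single fun j ↦ clm_ext_single fun i ↦ hL.ext fun u ↦ ?_
    refine congrArg (fun L : E4 →L[ℝ] ℝ ↦ L u) (clm_ext_single fun n ↦ ?_)
    have e1 : C (EuclideanSpace.single j 1) (EuclideanSpace.single i 1) =
        ∑ m, g.christoffel x m i j • (EuclideanSpace.single m 1 : E4) := by
      simp [C, sum_apply]
    have e2 := apply_christoffelMap hL.isInvertible (EuclideanSpace.single j 1)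
      (EuclideanSpace.single i 1) (EuclideanSpace.single n 1)
    rw [fderiv_apply_symm (g.differentiableAt_chartMetric hz) (g.eventually_chartMetric_symm hz)
      (EuclideanSpace.single n 1)] at e2
    simp only [← dGram_eq] at e2
    have e3 : ∀ c : Fin 4 → ℝ,
        ∑ m, (∑ l, (g.gram x)⁻¹ m l * c l) * g.gram x m n = c n := by
      intro c
      have hsymm : ∀ m, g.gram x m n = g.gram x n m := fun m ↦ g.symm x _ _
      have h1 := congrFun (congrArg (fun A : Matrix (Fin 4) (Fin 4) ℝ ↦ A.mulVec c)
        (Matrix.mul_nonsing_inv (g.gram x) (g.isUnit_det_gram x))) n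
      simp only [Matrix.one_mulVec, ← Matrix.mulVec_mulVec] at h1
      rw [← h1]
      simp only [hsymm, Matrix.mulVec, dotProduct]
      exact Finset.sum_congr rfl fun m _ ↦ mul_comm _ _
    have e4 : g.chartMetric x (extChartAt (𝓡 4) x x)
        (∑ m, g.christoffel x m i j • (EuclideanSpace.single m 1 : E4))
        (EuclideanSpace.single n 1) = ∑ m, g.christoffel x m i j * g.gram x m n := by
      simp [gram_eq]
    rw [e1, e4]
    have e5 := e3 fun l ↦ g.dGram x i j l + g.dGram x j i l - g.dGram x l i j
    have e6 : ∑ m, g.christoffel x m i j * g.gram x m n = 1 / 2 * (∑ m, (∑ l, (g.gram x)⁻¹ m l *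
        (g.dGram x i j l + g.dGram x j i l - g.dGram x l i j)) * g.gram x m n) := by
      rw [Finset.mul_sum]
      exact Finset.sum_congr rfl fun m _ ↦ by rw [christoffel]; ring
    rw [e6, e5]
    linarith
  exact congrArg (fun L : E4 →L[ℝ] E4 →L[ℝ] E4 ↦ L w v) key

end LorentzMetric

end ChartLeviCivita

/-! ### Connection, expansion and curvature in a fixed chart -/

section ChartCurvature

variable {M : Type*} [TopologicalSpace M] [ChartedSpace E4 M] [IsManifold (𝓡 4) ∞ M]

theorem two_le_infty : (2 : WithTop ℕ∞) ≤ ∞ := WithTop.coe_le_coe.2 (le_top : (2 : ℕ∞) ≤ ⊤)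

section

variable {V : Type*} [NormedAddCommGroup V] [NormedSpace ℝ V] {G : V → V →L[ℝ] V →L[ℝ] ℝ}
  {F : V → V} {z : V}

theorem covDeriv_of_eventually_const {w : V} (hF : F =ᶠ[𝓝 z] fun _ ↦ w) (v : V) :
    covDeriv G F z v = christoffelMap G z w v := by
  rw [covDeriv_apply, hF.fderiv_eq, hF.self_of_nhds]
  simp

theorem hasFDerivAt_christoffelMap_apply (hΓ : DifferentiableAt ℝ (christoffelMap G) z) (w v : V) :
    HasFDerivAt (fun y ↦ christoffelMap G y w v)
      (((fderiv ℝ (christoffelMap G) z).flip w).flip v) z := by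
  simpa using (hΓ.hasFDerivAt.clm_apply (hasFDerivAt_const w z)).clm_apply (hasFDerivAt_const v z)

theorem covDeriv_of_eventually_christoffelMap (hΓ : DifferentiableAt ℝ (christoffelMap G) z)
    {w v : V} (hF : F =ᶠ[𝓝 z] fun y ↦ christoffelMap G y w v) (u : V) :
    covDeriv G F z u = fderiv ℝ (christoffelMap G) z u w v +
      christoffelMap G z (christoffelMap G z w v) u := by
  rw [covDeriv_apply, ((hasFDerivAt_christoffelMap_apply hΓ w v).congr_of_eventuallyEq hF).fderiv,
    hF.self_of_nhds]
  rfl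

end

theorem chartField_extChartAt (x y : M) (hy : y ∈ (extChartAt (𝓡 4) x).source)
    (Y : Π y : M, TangentSpace (𝓡 4) y) :
    chartField x Y (extChartAt (𝓡 4) x y) = chartRep x Y y := by
  rw [chartField, (extChartAt (𝓡 4) x).left_inv hy]

theorem chartField_self (x : M) (Y : Π y : M, TangentSpace (𝓡 4) y) :
    chartField x Y (extChartAt (𝓡 4) x x) = Y x := by
  rw [chartField_extChartAt x x (mem_extChartAt_source x), chartRep_self]

theorem fromChart_chartField {x y : M} (hy : y ∈ (extChartAt (𝓡 4) x).source)
    (Y : Π y : M, TangentSpace (𝓡 4) y) :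
    fromChart x y (chartField x Y (extChartAt (𝓡 4) x y)) = Y y := by
  rw [chartField_extChartAt x y hy, fromChart_chartRep hy]

theorem fromChart_tangentCoordChange_comp {x y y' : M} (hx : y' ∈ (extChartAt (𝓡 4) x).source)
    (hy : y' ∈ (extChartAt (𝓡 4) y).source) (u : E4) :
    fromChart y y' (tangentCoordChange (𝓡 4) x y y' u) = fromChart x y' u :=
  tangentCoordChange_comp ⟨⟨hx, hy⟩, mem_extChartAt_source y'⟩

theorem chartField_extend {x : M} {z : E4} (hz : z ∈ (extChartAt (𝓡 4) x).target)
    (w : TangentSpace (𝓡 4) x) : chartField x (FiberBundle.extend E4 w) z = w :=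
  chartRep_extend ((extChartAt (𝓡 4) x).map_target hz) w

/-- Pulled back to the chart at `x`, both fields are constant. This removes the bracket term from
the Riemann curvature. -/
theorem mlieBracket_extend (x : M) (u v : TangentSpace (𝓡 4) x) :
    VectorField.mlieBracket (𝓡 4) (FiberBundle.extend E4 u : Π y : M, TangentSpace (𝓡 4) y)
      (FiberBundle.extend E4 v) x = 0 := by
  have hz := mem_extChartAt_target (I := 𝓡 4) x
  have h : ∀ v : TangentSpace (𝓡 4) x, VectorField.mpullbackWithin 𝓘(ℝ, E4) (𝓡 4)
      (extChartAt (𝓡 4) x).symm (FiberBundle.extend E4 v) (Set.range (𝓡 4))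
      =ᶠ[𝓝 (extChartAt (𝓡 4) x x)] fun _ ↦ (v : E4) := by
    intro v
    filter_upwards [(isOpen_extChartAt_target x).mem_nhds hz] with z hz'
    have hs := (extChartAt (𝓡 4) x).map_target hz'
    have hs' := hs
    rw [extChartAt_source] at hs'
    have h1 := TangentBundle.symmL_trivializationAt_eq_core (I := 𝓡 4) hs'
    rw [TangentBundle.symmL_trivializationAt (I := 𝓡 4) hs',
      (extChartAt (𝓡 4) x).right_inv hz'] at h1
    rw [VectorField.mpullbackWithin_apply, extend_eq_fromChart hs]
    have h2 : fromChart x ((extChartAt (𝓡 4) x).symm z) v = mfderivWithin 𝓘(ℝ, E4) (𝓡 4)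
        (extChartAt (𝓡 4) x).symm (Set.range (𝓡 4)) z v :=
      congrArg (fun L : E4 →L[ℝ] E4 ↦ L v) h1.symm
    exact (congrArg _ h2).trans
      ((isInvertible_mfderivWithin_extChartAt_symm (I := 𝓡 4) hz').inverse_apply_self v)
  rw [← VectorField.mlieBracketWithin_univ, VectorField.mlieBracketWithin_apply,
    (h u).lieBracketWithin_vectorField_eq_nhds (h v)]
  refine (congrArg _ ?_).trans (map_zero _)
  have h0 : ∀ (a b z : E4) (s : Set E4),
      VectorField.lieBracketWithin ℝ (fun _ : E4 ↦ a) (fun _ ↦ b) s z = 0 := by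
    simp [VectorField.lieBracketWithin]
  exact h0 u v _ _

namespace LorentzMetric

variable (g : LorentzMetric M)

theorem leviCivita_self {Y : Π y : M, TangentSpace (𝓡 4) y} {x : M}
    (hY : MDifferentiableAt (𝓡 4) ((𝓡 4).prod 𝓘(ℝ, E4))
      (fun y ↦ (⟨y, Y y⟩ : TangentBundle (𝓡 4) M)) x) (v : E4) :
    g.leviCivita Y x v =
      covDeriv (g.chartMetric x) (chartField x Y) (extChartAt (𝓡 4) x x) v := by
  refine congrArg₂ (fun a b : E4 ↦ a + b) (mvfderiv_apply_eq_fderiv (mdifferentiableAt_chartRep hY) v)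
    ((g.christoffelForm_eq x (Y x) v).trans ?_)
  rw [chartField_self]
  rfl

/-- The Levi-Civita connection at `y`, computed in the preferred chart at `x`. -/
theorem leviCivita_fromChart {Y : Π y : M, TangentSpace (𝓡 4) y} {x y : M}
    (hy : y ∈ (extChartAt (𝓡 4) x).source)
    (hY : MDifferentiableAt (𝓡 4) ((𝓡 4).prod 𝓘(ℝ, E4))
      (fun y ↦ (⟨y, Y y⟩ : TangentBundle (𝓡 4) M)) y) (u : E4) :
    g.leviCivita Y y (fromChart x y u) =
      fromChart x y
        (covDeriv (g.chartMetric x) (chartField x Y) (extChartAt (𝓡 4) x y) u) := by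
  set τ := extChartAt (𝓡 4) y ∘ (extChartAt (𝓡 4) x).symm with hτ
  have hys := mem_extChartAt_source (I := 𝓡 4) y
  have hz := (extChartAt (𝓡 4) x).map_source hy
  have hτz : τ (extChartAt (𝓡 4) x y) = extChartAt (𝓡 4) y y := by
    rw [hτ, Function.comp_apply, (extChartAt (𝓡 4) x).left_inv hy]
  have hA : fderiv ℝ τ (extChartAt (𝓡 4) x y) = fromChart x y := fderiv_chartTransition x y y
  -- Coordinates near that of `y` belong to points in both chart domains, where metric and field are
  -- related by the Jacobian of the transition map `τ`.
  have hev : ∀ᶠ z in 𝓝 (extChartAt (𝓡 4) x y), ∃ y' ∈ (extChartAt (𝓡 4) x).source,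
      y' ∈ (extChartAt (𝓡 4) y).source ∧ extChartAt (𝓡 4) x y' = z := by
    have hc : ContinuousAt (extChartAt (𝓡 4) x).symm (extChartAt (𝓡 4) x y) :=
      continuousAt_extChartAt_symm' hy
    have h1 : ∀ᶠ z in 𝓝 (extChartAt (𝓡 4) x y),
        (extChartAt (𝓡 4) x).symm z ∈ (extChartAt (𝓡 4) y).source :=
      hc.preimage_mem_nhds (by
        rw [(extChartAt (𝓡 4) x).left_inv hy]
        exact (isOpen_extChartAt_source y).mem_nhds hys)
    filter_upwards [h1, (isOpen_extChartAt_target x).mem_nhds hz] with z h2 h3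
    exact ⟨_, (extChartAt (𝓡 4) x).map_target h3, h2, (extChartAt (𝓡 4) x).right_inv h3⟩
  have hmy := mem_extChartAt_target (I := 𝓡 4) y
  have key := covDeriv_pullback (G := g.chartMetric x) (G' := g.chartMetric y)
    (K := chartField x Y) (K' := chartField y Y) (τ := τ) (z := extChartAt (𝓡 4) x y)
    ((contDiffAt_chartTransition hy hys).of_le two_le_infty)
    (by rw [hA]; exact (fromChartEquiv hy).surjective)
    (g.isLorentzianForm_chartMetric hz).isInvertible
    (by rw [hτz]; exact (g.isLorentzianForm_chartMetric hmy).isInvertible)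
    (by rw [hτz]; exact g.differentiableAt_chartMetric hmy)
    (by rw [hτz]; exact g.eventually_chartMetric_symm hmy)
    (differentiableAt_chartField hy hY)
    (by rw [hτz]; exact differentiableAt_chartField hys hY)
    (by
      filter_upwards [hev] with z h u v
      obtain ⟨y', h1, h2, rfl⟩ := h
      have h3 : τ (extChartAt (𝓡 4) x y') = extChartAt (𝓡 4) y y' := by
        rw [hτ, Function.comp_apply, (extChartAt (𝓡 4) x).left_inv h1]
      rw [h3, fderiv_chartTransition, g.chartMetric_extChartAt h1, g.chartMetric_extChartAt h2,
        fromChart_tangentCoordChange_comp h1 h2, fromChart_tangentCoordChange_comp h1 h2])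
    (by
      filter_upwards [hev] with z h
      obtain ⟨y', h1, h2, rfl⟩ := h
      have h3 : τ (extChartAt (𝓡 4) x y') = extChartAt (𝓡 4) y y' := by
        rw [hτ, Function.comp_apply, (extChartAt (𝓡 4) x).left_inv h1]
      rw [h3, fderiv_chartTransition, chartField_extChartAt x y' h1, chartField_extChartAt y y' h2,
        chartRep_eq, chartRep_eq]
      exact (tangentCoordChange_comp (I := 𝓡 4) (v := Y y') ⟨⟨mem_extChartAt_source y', h1⟩, h2⟩).symm)
    (g.differentiableAt_chartMetric hz) u
  rw [hA, hτz] at key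
  rw [key]
  exact g.leviCivita_self hY _

/-- The two endomorphisms are conjugate under `fromChart x y`. Since `y` ranges over the whole
domain of one chart, the formula can be differentiated. -/
theorem expansion_eq {k : Π y : M, TangentSpace (𝓡 4) y} {x y : M}
    (hy : y ∈ (extChartAt (𝓡 4) x).source)
    (hk : MDifferentiableAt (𝓡 4) ((𝓡 4).prod 𝓘(ℝ, E4))
      (fun y ↦ (⟨y, k y⟩ : TangentBundle (𝓡 4) M)) y) :
    g.expansion k y =
      traceCLM E4 (covDeriv (g.chartMetric x) (chartField x k) (extChartAt (𝓡 4) x y)) := by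
  rw [traceCLM_apply, ← LinearMap.trace_conj' _ (fromChartEquiv hy)]
  refine congrArg (LinearMap.trace ℝ E4) (LinearMap.ext fun v ↦ ?_)
  have h := g.leviCivita_fromChart hy hk ((fromChartEquiv hy).symm v)
  have e : fromChart x y ((fromChartEquiv hy).symm v) = v := (fromChartEquiv hy).apply_symm_apply v
  rw [e] at h
  exact h

/-- The components of the extended field are constant in this chart, so only the Christoffel term
survives. -/
theorem chartField_leviCivita_extend {x : M} {z : E4} (hz : z ∈ (extChartAt (𝓡 4) x).target)
    (w v : TangentSpace (𝓡 4) x) :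
    chartField x (fun y ↦ g.leviCivita (FiberBundle.extend E4 w) y (FiberBundle.extend E4 v y)) z =
      christoffelMap (g.chartMetric x) z w v := by
  obtain ⟨y, hy, rfl⟩ : ∃ y ∈ (extChartAt (𝓡 4) x).source, extChartAt (𝓡 4) x y = z :=
    ⟨_, (extChartAt (𝓡 4) x).map_target hz, (extChartAt (𝓡 4) x).right_inv hz⟩
  have h1 := g.leviCivita_fromChart hy
    ((contMDiffAt_extend_of_mem hy w).mdifferentiableAt (by simp)) v
  have h2 : chartField x (FiberBundle.extend E4 w) =ᶠ[𝓝 (extChartAt (𝓡 4) x y)]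
      fun _ ↦ (w : E4) := Filter.eventually_of_mem ((isOpen_extChartAt_target x).mem_nhds hz)
    fun z' hz' ↦ chartField_extend hz' w
  rw [chartField_extChartAt x y hy, chartRep_eq, extend_eq_fromChart hy v, h1,
    tangentCoordChange_fromChart hy]
  exact covDeriv_of_eventually_const h2 v

theorem leviCivita_leviCivita_extend (x : M) (u v w : TangentSpace (𝓡 4) x) :
    g.leviCivita (fun y ↦ g.leviCivita (FiberBundle.extend E4 w) y (FiberBundle.extend E4 v y))
      x u = fderiv ℝ (christoffelMap (g.chartMetric x)) (extChartAt (𝓡 4) x x) u w v +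
        christoffelMap (g.chartMetric x) (extChartAt (𝓡 4) x x)
          (christoffelMap (g.chartMetric x) (extChartAt (𝓡 4) x x) w v) u := by
  have hz := mem_extChartAt_target (I := 𝓡 4) x
  have h1 : chartField x
      (fun y ↦ g.leviCivita (FiberBundle.extend E4 w) y (FiberBundle.extend E4 v y))
      =ᶠ[𝓝 (extChartAt (𝓡 4) x x)] fun z ↦ christoffelMap (g.chartMetric x) z w v :=
    Filter.eventually_of_mem ((isOpen_extChartAt_target x).mem_nhds hz)
      fun z' hz' ↦ g.chartField_leviCivita_extend hz' w v
  have hΓ := differentiableAt_christoffelMap (g.isLorentzianForm_chartMetric hz).isInvertible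
    ((g.contDiffAt_chartMetric hz).of_le two_le_infty)
  have h3 := (hasFDerivAt_christoffelMap_apply hΓ w v).congr_of_eventuallyEq h1
  exact (g.leviCivita_self (mdifferentiableAt_of_chartField (mem_extChartAt_source x)
    h3.differentiableAt) u).trans (covDeriv_of_eventually_christoffelMap hΓ h1 u)

theorem riemann_eq (x : M) (u v w : TangentSpace (𝓡 4) x) :
    g.riemann x u v w =
      curvatureMap (g.chartMetric x) (extChartAt (𝓡 4) x x) v w u := by
  have h0 : ∀ a b c d : E4, (a + b) - (c + d) = a - c + b - d := fun a b c d ↦ by abel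
  unfold riemann
  dsimp only
  rw [mlieBracket_extend, map_zero, sub_zero, FiberBundle.extend_apply_self,
    FiberBundle.extend_apply_self, leviCivita_leviCivita_extend, leviCivita_leviCivita_extend]
  exact h0 _ _ _ _

theorem ricci_eq (x : M) (v w : TangentSpace (𝓡 4) x) :
    g.ricci x v w =
      traceCLM E4 (curvatureMap (g.chartMetric x) (extChartAt (𝓡 4) x x) v w) := by
  rw [traceCLM_apply, LinearMap.trace_eq_matrix_trace ℝ (EuclideanSpace.basisFun (Fin 4) ℝ).toBasis]
  simp only [ricci, riemann_eq, Matrix.trace, Matrix.diag_apply, LinearMap.toMatrix_apply]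
  refine Finset.sum_congr rfl fun i _ ↦ ?_
  simp
  rfl

end LorentzMetric

end ChartCurvature

/-! ### Raychaudhuri's inequality on the manifold -/

section NullHypersurface

variable {M : Type*} [TopologicalSpace M] [ChartedSpace E4 M] [IsManifold (𝓡 4) ∞ M]

theorem mfderiv_extChartAt_apply {x y : M} (hy : y ∈ (extChartAt (𝓡 4) x).source)
    (v : TangentSpace (𝓡 4) y) :
    mfderiv (𝓡 4) 𝓘(ℝ, E4) (extChartAt (𝓡 4) x) y v = tangentCoordChange (𝓡 4) y x y v := by
  rw [extChartAt_source] at hy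
  rw [← TangentBundle.continuousLinearMapAt_trivializationAt hy,
    TangentBundle.continuousLinearMapAt_trivializationAt_eq_core hy]
  rfl

section MapInCharts

variable {W H N : Type*} [NormedAddCommGroup W] [NormedSpace ℝ W] [TopologicalSpace H]
  {J : ModelWithCorners ℝ W H} [J.Boundaryless] [TopologicalSpace N] [ChartedSpace H N]
  [IsManifold J ∞ N] {F : N → M} {p : N}

omit [IsManifold (𝓡 4) ∞ M] [IsManifold J ∞ N] in
theorem fderiv_writtenInExtChartAt_apply (hF : MDifferentiableAt J (𝓡 4) F p) (v : W) :
    fderiv ℝ (writtenInExtChartAt J (𝓡 4) p F) (extChartAt J p p) v = mfderiv J (𝓡 4) F p v := by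
  have h : ∀ (f : W → E4) (L : W →L[ℝ] E4) (z : W),
      HasFDerivWithinAt f L (Set.range J) z → fderiv ℝ f z v = L v := by
    intro f L z hL
    rw [ModelWithCorners.range_eq_univ, hasFDerivWithinAt_univ] at hL
    rw [hL.fderiv]
  exact h _ _ _ hF.hasMFDerivAt.2

omit [IsManifold (𝓡 4) ∞ M] [IsManifold J ∞ N] in
theorem contDiffAt_writtenInExtChartAt {n : WithTop ℕ∞} (hF : ContMDiffAt J (𝓡 4) n F p) :
    ContDiffAt ℝ n (writtenInExtChartAt J (𝓡 4) p F) (extChartAt J p p) := by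
  have h := (contMDiffAt_iff.1 hF).2
  rwa [ModelWithCorners.range_eq_univ, contDiffWithinAt_univ] at h

/-- Chain rule through both charts. Existence of some `w` is enough, because it is used only for
orthogonality to all tangent vectors of the hypersurface. -/
theorem exists_fderiv_writtenInExtChartAt {q : W} (hq : q ∈ (extChartAt J p).target)
    (hF : MDifferentiableAt J (𝓡 4) F ((extChartAt J p).symm q))
    (hs : F ((extChartAt J p).symm q) ∈ (extChartAt (𝓡 4) (F p)).source) (v : W) :
    ∃ w : TangentSpace J ((extChartAt J p).symm q),
      fromChart (F p) (F ((extChartAt J p).symm q))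
        (fderiv ℝ (writtenInExtChartAt J (𝓡 4) p F) q v) =
      mfderiv J (𝓡 4) F ((extChartAt J p).symm q) w := by
  have h1 : MDifferentiableAt 𝓘(ℝ, W) J (extChartAt J p).symm q :=
    (mdifferentiableOn_extChartAt_symm (I := J) (x := p)).mdifferentiableAt
      ((isOpen_extChartAt_target p).mem_nhds hq)
  have h2 : MDifferentiableAt (𝓡 4) 𝓘(ℝ, E4) (extChartAt (𝓡 4) (F p))
      (F ((extChartAt J p).symm q)) :=
    mdifferentiableAt_extChartAt (by rwa [← extChartAt_source (𝓡 4)])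
  have h3 := h2.hasMFDerivAt.comp q (hF.hasMFDerivAt.comp q h1.hasMFDerivAt)
  have h4 : ∀ L : W →L[ℝ] E4,
      HasMFDerivAt 𝓘(ℝ, W) 𝓘(ℝ, E4) (writtenInExtChartAt J (𝓡 4) p F) q L →
      fderiv ℝ (writtenInExtChartAt J (𝓡 4) p F) q = L := fun L hL ↦ by
    have h : HasFDerivAt (writtenInExtChartAt J (𝓡 4) p F) L q := hasMFDerivAt_iff_hasFDerivAt.1 hL
    exact h.fderiv
  refine ⟨mfderiv 𝓘(ℝ, W) J (extChartAt J p).symm q v, ?_⟩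
  have h5 : fderiv ℝ (writtenInExtChartAt J (𝓡 4) p F) q v =
      mfderiv (𝓡 4) 𝓘(ℝ, E4) (extChartAt (𝓡 4) (F p)) (F ((extChartAt J p).symm q))
        (mfderiv J (𝓡 4) F ((extChartAt J p).symm q)
          (mfderiv 𝓘(ℝ, W) J (extChartAt J p).symm q v)) :=
    congrArg (fun L : W →L[ℝ] E4 ↦ L v) (h4 _ h3)
  rw [h5, mfderiv_extChartAt_apply hs]
  exact fromChart_tangentCoordChange hs _

end MapInCharts

namespace LorentzMetric

variable (g : LorentzMetric M) {U : Set M} {k : Π x : M, TangentSpace (𝓡 4) x}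

theorem hasFDerivAt_expansion (hU : IsOpen U) (hk : ContMDiffOn (𝓡 4) ((𝓡 4).prod 𝓘(ℝ, E4)) ∞
      (fun y ↦ (⟨y, k y⟩ : TangentBundle (𝓡 4) M)) U) {y : M} (hy : y ∈ U) :
    HasFDerivAt (g.expansion k ∘ (extChartAt (𝓡 4) y).symm)
      ((traceCLM E4).comp (fderiv ℝ (covDeriv (g.chartMetric y) (chartField y k))
        (extChartAt (𝓡 4) y y))) (extChartAt (𝓡 4) y y) := by
  have hz := mem_extChartAt_target (I := 𝓡 4) y
  have hys := mem_extChartAt_source (I := 𝓡 4) y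
  have hB := (hasFDerivAt_covDeriv (g.isLorentzianForm_chartMetric hz).isInvertible
    ((g.contDiffAt_chartMetric hz).of_le two_le_infty)
    ((contDiffAt_chartField le_rfl hys (hk.contMDiffAt (hU.mem_nhds hy))).of_le
      two_le_infty)).differentiableAt.hasFDerivAt
  refine ((traceCLM E4).hasFDerivAt.comp _ hB).congr_of_eventuallyEq ?_
  have h1 : ∀ᶠ z in 𝓝 (extChartAt (𝓡 4) y y), (extChartAt (𝓡 4) y).symm z ∈ U :=
    (continuousAt_extChartAt_symm y).preimage_mem_nhds
      (by rw [(extChartAt (𝓡 4) y).left_inv hys]; exact hU.mem_nhds hy)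
  filter_upwards [h1, (isOpen_extChartAt_target y).mem_nhds hz] with z h2 h3
  have h4 := g.expansion_eq ((extChartAt (𝓡 4) y).map_target h3)
    ((hk.contMDiffAt (hU.mem_nhds h2)).mdifferentiableAt (by simp))
  rw [(extChartAt (𝓡 4) y).right_inv h3] at h4
  exact h4

theorem mdifferentiableAt_expansion (hU : IsOpen U)
    (hk : ContMDiffOn (𝓡 4) ((𝓡 4).prod 𝓘(ℝ, E4)) ∞
      (fun y ↦ (⟨y, k y⟩ : TangentBundle (𝓡 4) M)) U) {y : M} (hy : y ∈ U) :
    MDifferentiableAt (𝓡 4) 𝓘(ℝ, ℝ) (g.expansion k) y :=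
  mdifferentiableAt_of_comp_symm (mem_extChartAt_source y)
    (g.hasFDerivAt_expansion hU hk hy).differentiableAt

theorem mvfderiv_expansion (hU : IsOpen U)
    (hk : ContMDiffOn (𝓡 4) ((𝓡 4).prod 𝓘(ℝ, E4)) ∞
      (fun y ↦ (⟨y, k y⟩ : TangentBundle (𝓡 4) M)) U) {y : M} (hy : y ∈ U)
    (v : TangentSpace (𝓡 4) y) :
    mvfderiv (𝓡 4) (g.expansion k) y v = traceCLM E4
      (fderiv ℝ (covDeriv (g.chartMetric y) (chartField y k)) (extChartAt (𝓡 4) y y) v) := by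
  rw [mvfderiv_apply_eq_fderiv (g.mdifferentiableAt_expansion hU hk hy),
    (g.hasFDerivAt_expansion hU hk hy).fderiv]
  rfl

theorem mdifferentiableAt_entropyFlux {σ : Π x : M, TangentSpace (𝓡 4) x} {y : M}
    (hk : MDifferentiableAt (𝓡 4) ((𝓡 4).prod 𝓘(ℝ, E4))
      (fun y ↦ (⟨y, k y⟩ : TangentBundle (𝓡 4) M)) y)
    (hσ : MDifferentiableAt (𝓡 4) ((𝓡 4).prod 𝓘(ℝ, E4))
      (fun y ↦ (⟨y, σ y⟩ : TangentBundle (𝓡 4) M)) y) :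
    MDifferentiableAt (𝓡 4) 𝓘(ℝ, ℝ) (g.entropyFlux k σ) y := by
  have h := MDifferentiableAt.clm_bundle_apply₂ (E₃ := Bundle.Trivial M ℝ) (F₃ := ℝ)
    (b := fun y : M ↦ y) ((g.smooth y).mdifferentiableAt (by simp)) hk hσ
  have h2 : MDifferentiableAt (𝓡 4) 𝓘(ℝ, ℝ) (fun y ↦ g.form y (k y) (σ y)) y :=
    (mdifferentiableAt_totalSpace _ _).1 h |>.2
  exact h2.neg

/-- Raychaudhuri's inequality along a null hypersurface ruled by affinely parametrized geodesics:
`kᵃ ∇_a θ ≤ -R_ab kᵃ kᵇ`. -/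
theorem mvfderiv_expansion_le {W H N : Type*} [NormedAddCommGroup W] [NormedSpace ℝ W]
    [FiniteDimensional ℝ W] [TopologicalSpace H] {J : ModelWithCorners ℝ W H} [J.Boundaryless]
    [TopologicalSpace N] [ChartedSpace H N] [IsManifold J ∞ N] {F : N → M} {p : N}
    (hdim : Module.finrank ℝ W = 3) (hU : IsOpen U)
    (hk : ContMDiffOn (𝓡 4) ((𝓡 4).prod 𝓘(ℝ, E4)) ∞
      (fun y ↦ (⟨y, k y⟩ : TangentBundle (𝓡 4) M)) U)
    (hk0 : ∀ y ∈ U, k y ≠ 0) (hnull : ∀ y ∈ U, g.form y (k y) (k y) = 0) (hp : F p ∈ U)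
    (hF : ∀ᶠ p' in 𝓝 p, ContMDiffAt J (𝓡 4) ∞ F p')
    (hinj : Function.Injective (mfderiv J (𝓡 4) F p))
    (horth : ∀ᶠ p' in 𝓝 p, ∀ v : TangentSpace J p',
      g.form (F p') (k (F p')) (mfderiv J (𝓡 4) F p' v) = 0)
    (hgeo : ∀ᶠ p' in 𝓝 p, g.leviCivita k (F p') (k (F p')) = 0) :
    mvfderiv (𝓡 4) (g.expansion k) (F p) (k (F p)) ≤ -g.ricci (F p) (k (F p)) (k (F p)) := by
  set y := F p with hy
  set f := writtenInExtChartAt J (𝓡 4) p F with hf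
  set q := extChartAt J p p with hq
  have hfq : f q = extChartAt (𝓡 4) y y := by
    simp only [hf, hq, writtenInExtChartAt, Function.comp_apply, extChartAt_to_inv]
    rfl
  have hz := mem_extChartAt_target (I := 𝓡 4) y
  have hys := mem_extChartAt_source (I := 𝓡 4) y
  have hF0 := hF.self_of_nhds
  have hc : Filter.Tendsto (extChartAt J p).symm (𝓝 q) (𝓝 p) := by
    have := continuousAt_extChartAt_symm (I := J) p
    rwa [ContinuousAt, extChartAt_to_inv] at this
  have hFc : ∀ᶠ p' in 𝓝 p, F p' ∈ U ∩ (extChartAt (𝓡 4) y).source :=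
    hF0.continuousAt.preimage_mem_nhds
      ((hU.inter (isOpen_extChartAt_source y)).mem_nhds ⟨hp, hys⟩)
  have hsymm : ∀ᶠ z in 𝓝 (extChartAt (𝓡 4) y y), (extChartAt (𝓡 4) y).symm z ∈ U :=
    (continuousAt_extChartAt_symm y).preimage_mem_nhds
      (by rw [(extChartAt (𝓡 4) y).left_inv hys]; exact hU.mem_nhds hp)
  have hK := chartField_self y k
  -- The coordinate inequality is applied in the chart at `y = F p`, with the hypersurface given by
  -- `F` written in charts; each hypothesis is carried over by `fromChart`.
  have key := fderiv_trace_covDeriv_le (G := g.chartMetric y) (K := chartField y k) (f := f)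
    (q := q) (by rw [hdim]; simp)
    (by
      rw [hfq]
      exact Filter.eventually_of_mem ((isOpen_extChartAt_target y).mem_nhds hz)
        fun z hz' ↦ g.isLorentzianForm_chartMetric hz')
    (by rw [hfq]; exact (g.contDiffAt_chartMetric hz).of_le two_le_infty)
    (by
      rw [hfq]
      exact (contDiffAt_chartField le_rfl hys (hk.contMDiffAt (hU.mem_nhds hp))).of_le
        two_le_infty)
    (by
      rw [hfq]
      filter_upwards [hsymm, (isOpen_extChartAt_target y).mem_nhds hz] with z h1 h2
      have h3 := (extChartAt (𝓡 4) y).map_target h2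
      rw [chartMetric_apply]
      have h4 : fromChart y ((extChartAt (𝓡 4) y).symm z) (chartField y k z) = k _ :=
        fromChart_chartRep h3 k
      rw [h4]
      exact hnull _ h1)
    (by rw [hfq, hK]; exact hk0 y hp)
    ((contDiffAt_writtenInExtChartAt hF0).of_le two_le_infty)
    (by
      intro a b hab
      have h := fderiv_writtenInExtChartAt_apply (hF0.mdifferentiableAt (by simp))
      rw [h, h] at hab
      exact hinj hab)
    (by
      filter_upwards [hc.eventually hFc, hc.eventually hgeo] with q' h1 h2
      have h3 := g.leviCivita_fromChart h1.2
        ((hk.contMDiffAt (hU.mem_nhds h1.1)).mdifferentiableAt (by simp))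
        (chartField y k (f q'))
      have h4 : fromChart y (F ((extChartAt J p).symm q')) (chartField y k (f q')) =
        k (F ((extChartAt J p).symm q')) := fromChart_chartField h1.2 k
      rw [h4, h2] at h3
      exact (fromChartEquiv h1.2).map_eq_zero_iff.1 h3.symm)
    (by
      filter_upwards [hc.eventually hFc, hc.eventually horth, hc.eventually hF,
        (isOpen_extChartAt_target p).mem_nhds (mem_extChartAt_target p)] with q' h1 h2 h3 h4 v
      obtain ⟨w, hw⟩ := exists_fderiv_writtenInExtChartAt h4 (h3.mdifferentiableAt (by simp))
        h1.2 v
      have h5 := g.chartMetric_extChartAt h1.2 (chartField y k (f q')) (fderiv ℝ f q' v)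
      have h6 : fromChart y (F ((extChartAt J p).symm q')) (chartField y k (f q')) =
        k (F ((extChartAt J p).symm q')) := fromChart_chartField h1.2 k
      rw [h6, hw] at h5
      exact h5.trans (h2 w))
  rw [hfq, hK] at key
  rw [g.mvfderiv_expansion hU hk hp, g.ricci_eq]
  exact key

end LorentzMetric

end NullHypersurface

/-! ### Monotonicity along the generators -/

theorem mainTheorem2 {M : Type*} [TopologicalSpace M] [T2Space M] [ChartedSpace E4 M]
    [IsManifold (𝓡 4) ∞ M]
    {S : Type*} [TopologicalSpace S] [ChartedSpace E2 S] [IsManifold (𝓡 2) ∞ S]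
    (g : LorentzMetric M)
    (T : Π x : M, TangentSpace (𝓡 4) x →L[ℝ] TangentSpace (𝓡 4) x →L[ℝ] ℝ)
    (hT : g.EinsteinEquation T)
    (U : Set M) (k : Π x : M, TangentSpace (𝓡 4) x) (D : Set (S × ℝ)) (Φ : S → ℝ → M)
    (hL : IsLightSheet g U k D Φ)
    (σ : Π x : M, TangentSpace (𝓡 4) x)
    (hσ : ContMDiffOn (𝓡 4) ((𝓡 4).prod 𝓘(ℝ, E4)) 1
      (fun y ↦ (⟨y, σ y⟩ : TangentBundle (𝓡 4) M)) U)
    (h_rate : ∀ p ∈ D, g.entropyFluxRate k σ (Φ p.1 p.2) ≤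
      2 * Real.pi * T (Φ p.1 p.2) (k (Φ p.1 p.2)) (k (Φ p.1 p.2)))
    (h_init : ∀ x : S, g.entropyFlux k σ (Φ x 0) ≤ -(1 / 4) * g.expansion k (Φ x 0)) :
    ∀ p ∈ D, g.entropyFlux k σ (Φ p.1 p.2) ≤ -(1 / 4) * g.expansion k (Φ p.1 p.2) := by
  rintro ⟨x, l⟩ hp
  have hθ : ∀ y ∈ U, MDifferentiableAt (𝓡 4) 𝓘(ℝ, ℝ) (g.expansion k) y := fun y hy ↦
    g.mdifferentiableAt_expansion hL.isOpen hL.smooth hy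
  have hs : ∀ y ∈ U, MDifferentiableAt (𝓡 4) 𝓘(ℝ, ℝ) (g.entropyFlux k σ) y := fun y hy ↦
    g.mdifferentiableAt_entropyFlux
      ((hL.smooth.contMDiffAt (hL.isOpen.mem_nhds hy)).mdifferentiableAt (by simp))
      ((hσ.contMDiffAt (hL.isOpen.mem_nhds hy)).mdifferentiableAt (by simp))
  have hl : 0 ≤ l := hL.nonneg _ hp
  have hD : ∀ m ∈ Set.Icc 0 l, (x, m) ∈ D := by
    rintro m ⟨h0, h1⟩
    rcases h0.eq_or_lt with rfl | h0
    · exact hL.zero_mem x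
    · rcases h1.eq_or_lt with rfl | h1
      · exact hp
      · exact interior_subset (hL.mem_interior x l m hp h0 h1)
  have hγ : IsMIntegralCurveOn (Φ x) k (Set.Icc 0 l) := (hL.generator x).mono hD
  have hderiv : ∀ {u : M → ℝ} {m : ℝ}, m ∈ Set.Ioo 0 l →
      MDifferentiableAt (𝓡 4) 𝓘(ℝ, ℝ) u (Φ x m) →
      HasDerivAt (fun t ↦ u (Φ x t)) (mvfderiv (𝓡 4) u (Φ x m) (k (Φ x m))) m := by
    intro u m hm hu
    have h1 := (hγ m (Set.Ioo_subset_Icc_self hm)).hasMFDerivAt (Icc_mem_nhds hm.1 hm.2)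
    have h2 := hu.hasMFDerivAt.comp m h1
    have h3 : ∀ (w : ℝ → ℝ) (L : ℝ →L[ℝ] ℝ), HasMFDerivAt 𝓘(ℝ, ℝ) 𝓘(ℝ, ℝ) w m L →
      HasDerivAt w (L 1) m := fun w L hw ↦ by
        have h : HasFDerivAt w L m := hasMFDerivAt_iff_hasFDerivAt.1 hw
        exact h.hasDerivAt
    have h4 : mvfderiv (𝓡 4) u (Φ x m) (k (Φ x m)) =
        mvfderiv (𝓡 4) u (Φ x m) ((1 : ℝ) • k (Φ x m)) := by rw [one_smul]
    rw [h4]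
    exact h3 _ _ h2
  have hcont : ∀ {u : M → ℝ}, (∀ y ∈ U, MDifferentiableAt (𝓡 4) 𝓘(ℝ, ℝ) u y) →
      ContinuousOn (fun t ↦ u (Φ x t)) (Set.Icc 0 l) := fun hu m hm ↦
    (hu _ (hL.mem_nhd _ (hD m hm))).continuousAt.comp_continuousWithinAt
      (hγ.continuousOn m hm)
  -- Raychaudhuri's inequality needs a neighbourhood in the sheet, which is available only for `0 <
  -- m < l`; continuity on the closed interval takes care of the two ends.
  have hanti : AntitoneOn (fun t ↦ g.entropyFlux k σ (Φ x t) + 1 / 4 * g.expansion k (Φ x t))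
      (Set.Icc 0 l) := by
    have hd : ∀ m ∈ Set.Ioo 0 l, HasDerivAt
        (fun t ↦ g.entropyFlux k σ (Φ x t) + 1 / 4 * g.expansion k (Φ x t))
        (g.entropyFluxRate k σ (Φ x m) +
          1 / 4 * mvfderiv (𝓡 4) (g.expansion k) (Φ x m) (k (Φ x m))) m := fun m hm ↦ by
      have hm' := hL.mem_nhd _ (hD m (Set.Ioo_subset_Icc_self hm))
      exact (hderiv hm (hs _ hm')).add ((hderiv hm (hθ _ hm')).const_mul (1 / 4))
    refine antitoneOn_of_deriv_nonpos (convex_Icc 0 l)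
      ((hcont hs).add (continuousOn_const.mul (hcont hθ))) ?_ ?_
    · rw [interior_Icc]
      exact fun m hm ↦ (hd m hm).differentiableAt.differentiableWithinAt
    · rw [interior_Icc]
      intro m hm
      rw [(hd m hm).deriv]
      have hmD := hD m (Set.Ioo_subset_Icc_self hm)
      have hmU := hL.mem_nhd _ hmD
      have hint := hL.mem_interior x l m hp hm.1 hm.2
      have hnhds : ∀ᶠ p' in 𝓝 (x, m), p' ∈ interior D := isOpen_interior.mem_nhds hint
      have h1 := g.mvfderiv_expansion_le (J := (𝓡 2).prod 𝓘(ℝ, ℝ))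
        (F := fun p : S × ℝ ↦ Φ p.1 p.2) (p := (x, m)) (by simp) hL.isOpen hL.smooth hL.ne_zero
        hL.null hmU
        (hnhds.mono fun p' h ↦ hL.hypersurface_smooth.contMDiffAt (isOpen_interior.mem_nhds h))
        (hL.hypersurface_immersed _ hint) (hnhds.mono fun p' h ↦ hL.hypersurface_null p' h)
        (hnhds.mono fun p' h ↦ hL.geodesic p' (interior_subset h))
      have h2 := h_rate _ hmD
      have h3 := hT (Φ x m) (k (Φ x m)) (k (Φ x m))
      -- Since `k` is null the scalar curvature term drops out, leaving `Ric(k,k) = 8π T(k,k)`; a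
      -- quarter of this is exactly the bound in `h_rate`.
      rw [hL.null _ hmU] at h3
      simp only at h1 h2
      linarith
  have h1 := hanti (Set.left_mem_Icc.2 hl) (Set.right_mem_Icc.2 hl) hl
  have h2 := h_init x
  simp only at h1 ⊢
  linarith

end
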